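/- A cell is a unit square of the lattice $\mathbb Z\times\mathbb Z$; a polyomino is a nonempty finite set of cells that is connected through common sides, taken up to translation, and it is convex if each of its rows and each of its columns is connected. Let $n\ge 2$ and let $P$ be a polyomino without holes having $n-1$ rows and $n-1$ columns, placed so that the south-west corner of its minimal bounding rectangle is $(1,1)$. Let $A_1,\dots,A_{2(r+1)}$ be the vertices (corners of the boundary) of $P$ in clockwise order, starting from the lowest leftmost vertex (the leftmost one among those of minimal ordinate). $P$ is a permutomino of size $n$ if $\{A_1,A_3,\dots,A_{2r+1}\}$ and $\{A_2,A_4,\dots,A_{2r+2}\}$ are the graphs $\{(i,\pi_1(i)):1\le i\le n\}$ and $\{(i,\pi_2(i)):1\le i\le n\}$ of two permutations $\pi_1=\pi_1(P)$ and $\pi_2=\pi_2(P)$ of $\{1,\dots,n\}$. By convention the empty set of cells is the only permutomino of size $1$; it is convex and $\pi_1=\pi_2=(1)$ for it. Let $\mathcal C_n$ be the set of convex permutominoes of size $n$, let $\widetilde{\mathcal C}_n=\{\pi_1(P):P\in\mathcal C_n\}$, and for $\pi\in\widetilde{\mathcal C}_n$ let $[\pi]=\{P\in\mathcal C_n:\pi_1(P)=\pi\}$.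 For a permutation $\pi$ of $\{1,\dots,n\}$ let $\mu(\pi)$ be its maximal upper unimodal sublist, that is, the sequence of the left-right maxima of $\pi$ (entries larger than all entries before them) followed by the right-left maxima of $\pi$ (entries larger than all entries after them), the common entry $n$ being listed once; its increasing part is the part up to the entry $n$. Let $\mathcal F(\pi)$ be the set of free fixed points of $\pi$, i.e. the fixed points of $\pi$ that lie in the increasing part of $\mu(\pi)$ and are different from $1$ and $n$. **Theorem.** For every $n\ge 1$ and every $\pi\in\widetilde{\mathcal C}_n$, the set $[\pi]$ is finite and $$\bigl|[\pi]\bigr| = 2^{|\mathcal F(\pi)|}.$$ -/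

import Mathlib

namespace Permutomino

/-! ### Polyominoes

The pair `(x, y)` stands for the unit square `[x, x+1] × [y, y+1]` when it is used as a cell and
for the lattice point with these coordinates when it is used as a point. -/

/-- Two cells are adjacent if they share a side. -/
def cellGraph : SimpleGraph (ℤ × ℤ) where
  Adj a b := |a.1 - b.1| + |a.2 - b.2| = 1
  symm := ⟨fun a b h => by rwa [abs_sub_comm b.1, abs_sub_comm b.2]⟩
  loopless := ⟨fun a h => by simp at h⟩

/-- A polyomino: a (nonempty) finite set of cells that is connected through sides, i.e. a finite
union of cells with connected interior. -/
def IsPolyomino (P : Finset (ℤ × ℤ)) : Prop :=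
  (cellGraph.induce (P : Set (ℤ × ℤ))).Connected

/-- No holes: the cells outside `P` are connected through sides, i.e. the complement of the closed
region covered by `P` is connected. -/
def HasNoHoles (P : Finset (ℤ × ℤ)) : Prop :=
  (cellGraph.induce ((P : Set (ℤ × ℤ))ᶜ)).Connected

/-- Every column is connected. -/
def IsColumnConvex (P : Finset (ℤ × ℤ)) : Prop :=
  ∀ x : ℤ, Set.OrdConnected {y : ℤ | (x, y) ∈ P}

/-- Every row is connected. -/
def IsRowConvex (P : Finset (ℤ × ℤ)) : Prop :=
  ∀ y : ℤ, Set.OrdConnected {x : ℤ | (x, y) ∈ P}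

/-- Convexity of a polyomino. -/
def IsConvex (P : Finset (ℤ × ℤ)) : Prop :=
  IsColumnConvex P ∧ IsRowConvex P

/-! ### The boundary, traversed clockwise -/

/-- The four unit steps: north, east, south, west. -/
inductive Step
  | north
  | east
  | south
  | west

/-- The displacement of a step. -/
def Step.vec : Step → ℤ × ℤ
  | .north => (0, 1)
  | .east => (1, 0)
  | .south => (0, -1)
  | .west => (-1, 0)

/-- The step is north or south. -/
def Step.IsVertical : Step → Prop
  | .north => True
  | .east => False
  | .south => True
  | .west => False

/-- The cell on the right-hand side of the step `d` that starts at the point `p`. -/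
def Step.rightCell (p : ℤ × ℤ) : Step → ℤ × ℤ
  | .north => (p.1, p.2)
  | .east => (p.1, p.2 - 1)
  | .south => (p.1 - 1, p.2 - 1)
  | .west => (p.1 - 1, p.2)

/-- The cell on the left-hand side of the step `d` that starts at the point `p`. -/
def Step.leftCell (p : ℤ × ℤ) : Step → ℤ × ℤ
  | .north => (p.1 - 1, p.2)
  | .east => (p.1, p.2)
  | .south => (p.1, p.2 - 1)
  | .west => (p.1 - 1, p.2 - 1)

/-- The step `d` from the point `p` runs along the boundary of `P` in the clockwise sense: `P` lies
on its right and the exterior of `P` on its left. -/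
def IsBoundaryStep (P : Finset (ℤ × ℤ)) (p : ℤ × ℤ) (d : Step) : Prop :=
  d.rightCell p ∈ P ∧ d.leftCell p ∉ P

/-- `p` is a vertex of `P`, i.e. a corner of its boundary: the boundary arrives at `p` by a step and
leaves it by a perpendicular step. -/
def IsVertex (P : Finset (ℤ × ℤ)) (p : ℤ × ℤ) : Prop :=
  ∃ d d' : Step, IsBoundaryStep P (p - d.vec) d ∧ IsBoundaryStep P p d' ∧
    (d.IsVertical ↔ ¬ d'.IsVertical)

/-- The straight segment from `p` to `q` is made of one or more steps of the boundary of `P`,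
traversed clockwise. -/
def IsClockwiseSide (P : Finset (ℤ × ℤ)) (p q : ℤ × ℤ) : Prop :=
  ∃ (d : Step) (k : ℕ), 0 < k ∧ q = p + k • d.vec ∧
    ∀ j < k, IsBoundaryStep P (p + j • d.vec) d

/-- `A 0, A 1, …, A (2 * r + 1)` is the list of the vertices of `P` in clockwise order, each of them
listed once, starting from the lowest leftmost vertex (the leftmost one among those with minimal
ordinate). -/
structure IsVertexList (P : Finset (ℤ × ℤ)) (r : ℕ) (A : Fin (2 * (r + 1)) → ℤ × ℤ) : Prop where
  injective : Function.Injective A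
  range_eq : Set.range A = {p | IsVertex P p}
  side : ∀ i, IsClockwiseSide P (A i) (A (finRotate _ i))
  first : ∀ p, IsVertex P p → (A ⟨0, by omega⟩).2 < p.2 ∨
    ((A ⟨0, by omega⟩).2 = p.2 ∧ (A ⟨0, by omega⟩).1 ≤ p.1)

/-! ### Permutominoes -/

/-- The points `(i, π(i))`, `1 ≤ i ≤ n`. A permutation of `{1, …, n}` is written as a permutation of
`Fin n`, whose elements are `0, …, n - 1`; hence the shifts by one. -/
def graphOf {n : ℕ} (π : Equiv.Perm (Fin n)) : Set (ℤ × ℤ) :=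
  Set.range fun i : Fin n => ((i : ℤ) + 1, (π i : ℤ) + 1)

/-- `P` is a nonempty permutomino of size `n` with `π₁(P) = π₁` and `π₂(P) = π₂`: a polyomino
without holes, with `n - 1` rows and `n - 1` columns, the south-west corner of whose minimal bounding
rectangle is `(1, 1)`, such that the first, third, fifth, … vertices represent `π₁` and the second,
fourth, sixth, … vertices represent `π₂`. -/
structure IsNonemptyPermutomino (n : ℕ) (P : Finset (ℤ × ℤ)) (π₁ π₂ : Equiv.Perm (Fin n)) :
    Prop where
  polyomino : IsPolyomino P
  noHoles : HasNoHoles P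
  columns : P.image Prod.fst = Finset.Icc 1 ((n : ℤ) - 1)
  rows : P.image Prod.snd = Finset.Icc 1 ((n : ℤ) - 1)
  vertices : ∃ (r : ℕ) (A : Fin (2 * (r + 1)) → ℤ × ℤ), IsVertexList P r A ∧
    (Set.range fun i : Fin (r + 1) => A ⟨2 * i, by omega⟩) = graphOf π₁ ∧
    (Set.range fun i : Fin (r + 1) => A ⟨2 * i + 1, by omega⟩) = graphOf π₂

/-- `P` is a permutomino of size `n` with `π₁(P) = π₁` and `π₂(P) = π₂`. By convention the empty
set of cells is a permutomino of size `1`, associated with the permutation of one element. -/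
def IsPermutominoWith (n : ℕ) (P : Finset (ℤ × ℤ)) (π₁ π₂ : Equiv.Perm (Fin n)) : Prop :=
  (n = 1 ∧ P = ∅) ∨ IsNonemptyPermutomino n P π₁ π₂

/-- The set of convex permutominoes of size `n`. -/
def convexPermutominoes (n : ℕ) : Set (Finset (ℤ × ℤ)) :=
  {P | IsConvex P ∧ ∃ π₁ π₂ : Equiv.Perm (Fin n), IsPermutominoWith n P π₁ π₂}

/-- `π₁(P) = π`. -/
def HasPi1 {n : ℕ} (P : Finset (ℤ × ℤ)) (π : Equiv.Perm (Fin n)) : Prop :=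
  ∃ π₂ : Equiv.Perm (Fin n), IsPermutominoWith n P π π₂

/-- `[π]`: the convex permutominoes `P` of size `n` with `π₁(P) = π`. -/
def associated {n : ℕ} (π : Equiv.Perm (Fin n)) : Set (Finset (ℤ × ℤ)) :=
  {P | P ∈ convexPermutominoes n ∧ HasPi1 P π}

/-- The permutations of the form `π₁(P)` with `P` a convex permutomino of size `n`. -/
def associatedPerms (n : ℕ) : Set (Equiv.Perm (Fin n)) :=
  {π | ∃ P ∈ convexPermutominoes n, HasPi1 P π}

/-! ### Free fixed points -/

/-- The entry at position `i` is a left-right maximum. -/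
def IsLeftRightMax {n : ℕ} (π : Equiv.Perm (Fin n)) (i : Fin n) : Prop :=
  ∀ j, j < i → π j < π i

/-- The entry at position `i` is a right-left maximum. -/
def IsRightLeftMax {n : ℕ} (π : Equiv.Perm (Fin n)) (i : Fin n) : Prop :=
  ∀ j, i < j → π j < π i

/-- The positions of the entries of `μ(π)`, the maximal upper unimodal sublist of `π`: the
left-right maxima followed by the right-left maxima. -/
def mu {n : ℕ} (π : Equiv.Perm (Fin n)) : Set (Fin n) :=
  {i | IsLeftRightMax π i ∨ IsRightLeftMax π i}

/-- The positions of the entries in the increasing part of `μ(π)`, i.e. up to the entry `n`. -/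
def muIncreasing {n : ℕ} (π : Equiv.Perm (Fin n)) : Set (Fin n) :=
  {i | i ∈ mu π ∧ ∀ j : Fin n, (π j : ℕ) + 1 = n → i ≤ j}

/-- The free fixed points of `π`: the fixed points in the increasing part of `μ(π)` which are
different from `1` and `n`. -/
def freeFixedPoints {n : ℕ} (π : Equiv.Perm (Fin n)) : Set (Fin n) :=
  {i | π i = i ∧ i ∈ muIncreasing π ∧ (i : ℕ) + 1 ≠ 1 ∧ (i : ℕ) + 1 ≠ n}

end Permutomino

/-!
A convex polyomino lies in each column between a bottom and a top ordinate. For a permutomino every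
abscissa carries exactly one point of `π₁` and one point of `π₂`, so at each inner abscissa exactly
one of the two ordinates changes, and following the boundary clockwise shows where the point of `π₁`
sits: it is the old top if the top changes, and the new bottom if the bottom changes. Hence the
region is determined by `π₁` and the set `U` of positions whose point lies on the top: the top in a
column is the value of `π₁` at the next position in `U` (`nxt`), the bottom is its value at the
last position not in `U` (`prv`). The sets `U` that arise are the `Admissible` ones: the bottom
stays below the top, `π₁` has no valley along `U` and no peak along the complement of `U`; see
`Encodes.admissible` and `Admissible.cells_mem_associated`. For the latter, the boundary visits the
positions along `U` from left to right and then along the complement from right to left, which is a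
single cycle (`Anchored.rotPerm_isCycleOn`) and so yields the list of vertices, from which `π₂` is
read off. Thus `[π]` is in bijection with the admissible sets (`mem_associated_iff`,
`cells_injOn`).

It remains to count admissible sets. A point on the top faces an empty quadrant, either to the
north-west or to the north-east, and a point on the bottom faces one to the south-west or to the
south-east. If a position lies in one admissible set and not in another, its point faces one
quadrant of each kind; since in the first region some point of `π` lies to the south-west of it, and
in the second one some point lies to the north-east, the empty quadrants are the north-west and the
south-east one. So `π` splits at this position, which is then a free fixed point
(`Admissible.mem_freeFixedPoints`). Conversely, a free fixed point may be put into an admissible set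
or taken out of it without destroying admissibility (`Admissible.insert_of_free`,
`Admissible.erase_of_free`), because its value is comparable with all values to its left and to its
right. Therefore the admissible sets are obtained from any one of them by choosing an arbitrary
subset of the free fixed points (`Admissible.ncard_setOf`).
-/

namespace Permutomino

/-! ### Column profiles -/

/-- The cells of `P` in the columns `1, …, n - 1` are those between a bottom function `b` and a top
function `t`, no other column meets `P`, no column is empty, and consecutive columns share a side.
The last condition excludes points where the boundary of `P` touches itself. -/
structure ColumnProfile (n : ℤ) (P : Finset (ℤ × ℤ)) (b t : ℤ → ℤ) : Prop where
  mem_iff : ∀ x y, (x, y) ∈ P ↔ (1 ≤ x ∧ x < n) ∧ b x ≤ y ∧ y < t x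
  lt : ∀ x, 1 ≤ x → x < n → b x < t x
  lt_succ : ∀ x, 1 ≤ x → x + 1 < n → b x < t (x + 1)
  succ_lt : ∀ x, 1 ≤ x → x + 1 < n → b (x + 1) < t x

theorem exists_bounds_of_ordConnected {s : Set ℤ} (hfin : s.Finite) (hne : s.Nonempty)
    (h : s.OrdConnected) : ∃ b t : ℤ, ∀ y, y ∈ s ↔ b ≤ y ∧ y < t := by
  obtain ⟨b, hb, hb'⟩ := s.exists_min_image id hfin hne
  obtain ⟨t, ht, ht'⟩ := s.exists_max_image id hfin hne
  refine ⟨b, t + 1, fun y => ⟨fun hy => ⟨hb' y hy, ?_⟩, fun hy => h.out hb ht ⟨hy.1, ?_⟩⟩⟩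
  · have := ht' y hy
    simp only [id] at this
    omega
  · omega

/-- A connected polyomino with cells in the columns `≤ k` and in the columns `> k` has two adjacent
cells in the columns `k` and `k + 1`. -/
theorem IsPolyomino.exists_adjacent_columns {P : Finset (ℤ × ℤ)} (hP : IsPolyomino P) {k : ℤ}
    {u v : ℤ × ℤ} (hu : u ∈ P) (hv : v ∈ P) (huk : u.1 ≤ k) (hvk : k < v.1) :
    ∃ y, (k, y) ∈ P ∧ (k + 1, y) ∈ P := by
  obtain ⟨p⟩ := hP.preconnected ⟨u, hu⟩ ⟨v, hv⟩
  obtain ⟨d, -, h1, h2⟩ := p.exists_boundary_dart {w | w.1.1 ≤ k} huk (by simpa using hvk)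
  obtain ⟨⟨⟨⟨x, y⟩, hxy⟩, ⟨⟨x', y'⟩, hxy'⟩⟩, hadj⟩ := d
  have hadj : |x - x'| + |y - y'| = 1 := hadj
  simp only [Set.mem_ofPred_eq] at h1 h2
  have : x = k ∧ x' = k + 1 ∧ y = y' := by grind
  obtain ⟨rfl, rfl, rfl⟩ := this
  exact ⟨y, hxy, hxy'⟩

theorem exists_columnProfile {n : ℤ} {P : Finset (ℤ × ℤ)} (hP : IsPolyomino P)
    (hconv : IsColumnConvex P) (hcol : P.image Prod.fst = Finset.Icc 1 (n - 1)) :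
    ∃ b t : ℤ → ℤ, ColumnProfile n P b t := by
  have hcol' : ∀ x, (1 ≤ x ∧ x < n) ↔ ∃ y, (x, y) ∈ P := by
    intro x
    have := Finset.ext_iff.1 hcol x
    simp only [Finset.mem_image, Prod.exists, exists_and_right, exists_eq_right,
      Finset.mem_Icc] at this
    rw [this]
    omega
  have key : ∀ x, ∃ b t : ℤ, (1 ≤ x ∧ x < n) → ∀ y, (x, y) ∈ P ↔ b ≤ y ∧ y < t := by
    intro x
    by_cases hx : 1 ≤ x ∧ x < n
    · obtain ⟨b, t, h⟩ := exists_bounds_of_ordConnected (s := {y | (x, y) ∈ P})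
        (P.finite_toSet.preimage (f := fun y => (x, y)) fun _ _ _ _ h => by simpa using h)
        ((hcol' x).1 hx) (hconv x)
      exact ⟨b, t, fun _ => h⟩
    · exact ⟨0, 0, fun h => absurd h hx⟩
  choose b t hbt using key
  have hmem : ∀ x y, (x, y) ∈ P ↔ (1 ≤ x ∧ x < n) ∧ b x ≤ y ∧ y < t x := by
    intro x y
    constructor
    · intro h
      have hx := (hcol' x).2 ⟨y, h⟩
      exact ⟨hx, (hbt x hx y).1 h⟩
    · rintro ⟨hx, h⟩
      exact (hbt x hx y).2 h
  have hover : ∀ x, 1 ≤ x → x + 1 < n → ∃ y, (x, y) ∈ P ∧ (x + 1, y) ∈ P := by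
    intro x h1 h2
    obtain ⟨y, hy⟩ := (hcol' x).1 ⟨h1, by omega⟩
    obtain ⟨y', hy'⟩ := (hcol' (x + 1)).1 ⟨by omega, h2⟩
    exact hP.exists_adjacent_columns hy hy' le_rfl (by simp)
  refine ⟨b, t, hmem, fun x h1 h2 => ?_, fun x h1 h2 => ?_, fun x h1 h2 => ?_⟩
  · obtain ⟨y, hy⟩ := (hcol' x).1 ⟨h1, h2⟩
    rw [hmem] at hy
    omega
  · obtain ⟨y, hy, hy'⟩ := hover x h1 h2
    rw [hmem] at hy hy'
    omega
  · obtain ⟨y, hy, hy'⟩ := hover x h1 h2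
    rw [hmem] at hy hy'
    omega

/-! ### Connectedness of sets of cells -/

/-- Two cells of `S` are joined by a path of adjacent cells of `S`. -/
def Joined (S : Set (ℤ × ℤ)) (u v : ℤ × ℤ) : Prop :=
  ∃ (hu : u ∈ S) (hv : v ∈ S), (cellGraph.induce S).Reachable ⟨u, hu⟩ ⟨v, hv⟩

theorem Joined.refl {S : Set (ℤ × ℤ)} {u : ℤ × ℤ} (h : u ∈ S) : Joined S u u :=
  ⟨h, h, SimpleGraph.Reachable.refl _⟩

theorem Joined.symm {S : Set (ℤ × ℤ)} {u v : ℤ × ℤ} : Joined S u v → Joined S v u :=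
  fun ⟨hu, hv, h⟩ => ⟨hv, hu, h.symm⟩

theorem Joined.trans {S : Set (ℤ × ℤ)} {u v w : ℤ × ℤ} :
    Joined S u v → Joined S v w → Joined S u w :=
  fun ⟨hu, _, h⟩ ⟨_, hw, h'⟩ => ⟨hu, hw, h.trans h'⟩

theorem Joined.of_adj {S : Set (ℤ × ℤ)} {u v : ℤ × ℤ} (hu : u ∈ S) (hv : v ∈ S)
    (h : cellGraph.Adj u v) : Joined S u v :=
  ⟨hu, hv, SimpleGraph.Adj.reachable h⟩

theorem joined_vertical {S : Set (ℤ × ℤ)} {x y y' : ℤ} (hy : y ≤ y')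
    (h : ∀ z, y ≤ z → z ≤ y' → (x, z) ∈ S) : Joined S (x, y) (x, y') := by
  induction y', hy using Int.leInduction with
  | base => exact .refl (h y le_rfl le_rfl)
  | succ m hm ih =>
    refine (ih fun z h1 h2 => h z h1 (by omega)).trans
      (.of_adj (h m hm (by omega)) (h (m + 1) (by omega) le_rfl) ?_)
    simp [cellGraph]

theorem joined_horizontal {S : Set (ℤ × ℤ)} {x x' y : ℤ} (hx : x ≤ x')
    (h : ∀ z, x ≤ z → z ≤ x' → (z, y) ∈ S) : Joined S (x, y) (x', y) := by
  induction x', hx using Int.leInduction with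
  | base => exact .refl (h x le_rfl le_rfl)
  | succ m hm ih =>
    refine (ih fun z h1 h2 => h z h1 (by omega)).trans
      (.of_adj (h m hm (by omega)) (h (m + 1) (by omega) le_rfl) ?_)
    simp [cellGraph]

theorem connected_of_forall_joined {S : Set (ℤ × ℤ)} {u : ℤ × ℤ} (hu : u ∈ S)
    (h : ∀ v ∈ S, Joined S v u) : (cellGraph.induce S).Connected := by
  rw [SimpleGraph.connected_iff_exists_forall_reachable]
  refine ⟨⟨u, hu⟩, fun v => ?_⟩
  obtain ⟨_, _, h⟩ := h v.1 v.2
  exact h.symm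

namespace ColumnProfile

variable {n : ℤ} {P : Finset (ℤ × ℤ)} {b t : ℤ → ℤ}

theorem isPolyomino (h : ColumnProfile n P b t) (hn : 2 ≤ n) : IsPolyomino P := by
  have hbot : ∀ x, 1 ≤ x → x < n → Joined (P : Set (ℤ × ℤ)) (x, b x) (1, b 1) := by
    intro x hx
    induction x, hx using Int.leInduction with
    | base =>
      intro _
      exact .refl ((h.mem_iff _ _).2 ⟨by omega, le_rfl, h.lt 1 le_rfl (by omega)⟩)
    | succ m hm ih =>
      intro hmn
      refine Joined.trans ?_ (ih (by omega))
      have h1 := h.lt m hm (by omega)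
      have h2 := h.lt (m + 1) (by omega) hmn
      have h3 := h.lt_succ m hm hmn
      have h4 := h.succ_lt m hm hmn
      -- the row of the higher of the two bottom cells meets both columns
      have hz : ∃ z, b m ≤ z ∧ z < t m ∧ b (m + 1) ≤ z ∧ z < t (m + 1) :=
        ⟨max (b m) (b (m + 1)), by omega⟩
      obtain ⟨z, hz1, hz2, hz3, hz4⟩ := hz
      refine (joined_vertical hz3 fun w hw hw' => ?_).trans
        ((joined_horizontal (x := m) (y := z) (by omega) fun w hw hw' => ?_).symm.trans
          (joined_vertical hz1 fun w hw hw' => ?_).symm)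
      · exact (h.mem_iff _ _).2 (by omega)
      · obtain rfl | rfl : w = m ∨ w = m + 1 := by omega
        · exact (h.mem_iff _ _).2 (by omega)
        · exact (h.mem_iff _ _).2 (by omega)
      · exact (h.mem_iff _ _).2 (by omega)
  refine connected_of_forall_joined (u := (1, b 1))
    ((h.mem_iff _ _).2 ⟨by omega, le_rfl, h.lt 1 le_rfl (by omega)⟩) ?_
  rintro ⟨x, y⟩ hxy
  have hxy' := (h.mem_iff _ _).1 hxy
  refine Joined.trans (Joined.symm (joined_vertical hxy'.2.1 fun w hw hw' => ?_))
    (hbot x hxy'.1.1 hxy'.1.2)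
  exact (h.mem_iff _ _).2 (by omega)

/-- Every cell outside `P` can escape vertically to one of two rows that do not meet `P`, and these
rows are joined through column `0`. -/
theorem hasNoHoles (h : ColumnProfile n P b t) {m M : ℤ}
    (hm : ∀ x, 1 ≤ x → x < n → m < b x) (hM : ∀ x, 1 ≤ x → x < n → t x ≤ M) : HasNoHoles P := by
  have hout : ∀ {x y : ℤ}, ¬ ((1 ≤ x ∧ x < n) ∧ b x ≤ y ∧ y < t x) →
      (x, y) ∈ (P : Set (ℤ × ℤ))ᶜ := by
    intro x y hxy hP
    exact hxy ((h.mem_iff x y).1 hP)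
  have hcol : ∀ y y', Joined (P : Set (ℤ × ℤ))ᶜ (0, y) (0, y') := by
    intro y y'
    rcases le_total y y' with hy | hy
    · exact joined_vertical hy fun w _ _ => hout (by omega)
    · exact (joined_vertical hy fun w _ _ => hout (by omega)).symm
  have hrow : ∀ z, (∀ x, 1 ≤ x → x < n → z < b x ∨ t x ≤ z) → ∀ x,
      Joined (P : Set (ℤ × ℤ))ᶜ (x, z) (0, m) := by
    intro z hz x
    have hz' : ∀ w, (w, z) ∈ (P : Set (ℤ × ℤ))ᶜ := fun w => hout fun hw => by
      have := hz w hw.1.1 hw.1.2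
      omega
    refine Joined.trans ?_ (hcol z m)
    rcases le_total x 0 with hx | hx
    · exact joined_horizontal hx fun w _ _ => hz' w
    · exact (joined_horizontal hx fun w _ _ => hz' w).symm
  refine connected_of_forall_joined (u := (0, m)) (hout (by omega)) ?_
  rintro ⟨x, y⟩ hxy
  have hxy' : ¬ ((1 ≤ x ∧ x < n) ∧ b x ≤ y ∧ y < t x) := fun hc => hxy ((h.mem_iff x y).2 hc)
  by_cases hx : 1 ≤ x ∧ x < n
  · have hmx := hm x hx.1 hx.2
    have hMx := hM x hx.1 hx.2
    by_cases hy : b x ≤ y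
    · by_cases hyM : y ≤ M
      · exact (joined_vertical hyM fun w _ _ => hout (by omega)).trans
          (hrow M (fun x h1 h2 => Or.inr (hM x h1 h2)) x)
      · exact (joined_vertical (y := M) (by omega) fun w _ _ => hout (by omega)).symm.trans
          (hrow M (fun x h1 h2 => Or.inr (hM x h1 h2)) x)
    · by_cases hym : y ≤ m
      · exact (joined_vertical hym fun w _ _ => hout (by omega)).trans
          (hrow m (fun x h1 h2 => Or.inl (hm x h1 h2)) x)
      · exact (joined_vertical (y := m) (by omega) fun w _ _ => hout (by omega)).symm.trans
          (hrow m (fun x h1 h2 => Or.inl (hm x h1 h2)) x)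
  · refine Joined.trans ?_ (hrow m (fun x h1 h2 => Or.inl (hm x h1 h2)) x)
    rcases le_total y m with hy | hy
    · exact joined_vertical hy fun w _ _ => hout (by omega)
    · exact (joined_vertical hy fun w _ _ => hout (by omega)).symm

/-- Consecutive columns overlap, so the columns cannot pass from one side of a row to the other
without meeting it. -/
theorem exists_mem_row (h : ColumnProfile n P b t) {x₁ x₂ y : ℤ} (h₁ : 1 ≤ x₁) (h₁' : x₁ < n)
    (h₂ : 1 ≤ x₂) (h₂' : x₂ < n) (hb : b x₁ ≤ y) (ht : y < t x₂) : ∃ x, (x, y) ∈ P := by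
  by_contra hne
  have hne' : ∀ x, 1 ≤ x → x < n → y < b x ∨ t x ≤ y := by
    intro x hx hx'
    by_contra hc
    exact hne ⟨x, (h.mem_iff x y).2 (by omega)⟩
  have hx₁ : t x₁ ≤ y := by
    have := hne' x₁ h₁ h₁'
    omega
  have : t x₂ ≤ y := by
    rcases le_total x₁ x₂ with hx | hx
    · clear ht
      induction x₂, hx using Int.leInduction with
      | base => exact hx₁
      | succ m hm ih =>
        have h3 := h.succ_lt m (by omega) h₂'
        have h4 := ih (by omega) (by omega)
        have h5 := hne' (m + 1) (by omega) h₂'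
        omega
    · clear ht
      induction x₂, hx using Int.leInductionDown with
      | base => exact hx₁
      | pred m hm ih =>
        have h3 := h.lt_succ (m - 1) (by omega) (by omega)
        have h4 := ih (by omega) (by omega)
        have h5 := hne' (m - 1) (by omega) (by omega)
        rw [sub_add_cancel] at h3
        omega
  omega

end ColumnProfile

/-- The top function of a row convex region has no strict local valley. -/
theorem no_valley_of_rowConvex {n : ℤ} {b t : ℤ → ℤ}
    (hlt : ∀ x, 1 ≤ x → x + 1 < n → b x < t (x + 1))
    (hrow : ∀ x₁ x₂ x₃ y, 1 ≤ x₁ → x₁ ≤ x₂ → x₂ ≤ x₃ → x₃ < n → b x₁ ≤ y → y < t x₁ →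
      b x₃ ≤ y → y < t x₃ → b x₂ ≤ y ∧ y < t x₂)
    (hlt' : ∀ x, 1 ≤ x → x + 1 < n → b (x + 1) < t x)
    {x₁ x₂ x₃ : ℤ} (h₁ : 1 ≤ x₁) (h₁₂ : x₁ < x₂) (h₂₃ : x₂ < x₃) (h₃ : x₃ < n)
    (hlow : t x₂ < t x₃) : t x₁ ≤ t x₂ := by
  -- an ascent of the top bounds everything to its left
  have hleft : ∀ i, 1 ≤ i → i + 1 < n → t i < t (i + 1) → ∀ x, x ≤ i → 1 ≤ x → t x ≤ t i := by
    intro i hi hin hasc x hx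
    induction x, hx using Int.leInductionDown with
    | base => exact fun _ => le_rfl
    | pred m hm ih =>
      intro h1
      have h3 := hlt (m - 1) h1 (by omega)
      rw [sub_add_cancel] at h3
      have h4 := ih (by omega)
      by_contra hc
      have := hrow (m - 1) i (i + 1) (t i) h1 (by omega) (by omega) hin (by omega) (by omega)
        (hlt' i hi hin).le hasc
      omega
  have hasc : ∃ i, x₂ ≤ i ∧ i < x₃ ∧ t i ≤ t x₂ ∧ t x₂ < t (i + 1) := by
    by_contra hc
    have : ∀ x, x₂ ≤ x → x ≤ x₃ → t x ≤ t x₂ := by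
      intro x hx
      induction x, hx using Int.leInduction with
      | base => exact fun _ => le_rfl
      | succ m hm ih =>
        intro h1
        by_contra h2
        exact hc ⟨m, hm, by omega, ih (by omega), by omega⟩
    have := this x₃ h₂₃.le le_rfl
    omega
  obtain ⟨i, h1, h2, h3, h4⟩ := hasc
  exact (hleft i (by omega) (by omega) (by omega) x₁ (by omega) h₁).trans h3

/-! ### Vertices of a column profile -/

theorem isBoundaryStep_iff {P : Finset (ℤ × ℤ)} {p : ℤ × ℤ} {d : Step} :
    IsBoundaryStep P p d ↔ d.rightCell p ∈ P ∧ d.leftCell p ∉ P := Iff.rfl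

namespace ColumnProfile

variable {n : ℤ} {P : Finset (ℤ × ℤ)} {b t : ℤ → ℤ}

/-- Two cells of `P` that touch at a corner have a common neighbour in `P`. -/
theorem no_pinch (h : ColumnProfile n P b t) (x y : ℤ) :
    ¬ ((x, y) ∈ P ∧ (x - 1, y - 1) ∈ P ∧ (x - 1, y) ∉ P ∧ (x, y - 1) ∉ P) ∧
    ¬ ((x, y) ∉ P ∧ (x - 1, y - 1) ∉ P ∧ (x - 1, y) ∈ P ∧ (x, y - 1) ∈ P) := by
  simp only [h.mem_iff]
  have h1 := h.lt_succ (x - 1)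
  have h2 := h.succ_lt (x - 1)
  rw [sub_add_cancel] at h1 h2
  constructor
  · intro hc
    have := h1 (by omega) (by omega)
    have := h2 (by omega) (by omega)
    omega
  · intro hc
    have := h1 (by omega) (by omega)
    have := h2 (by omega) (by omega)
    omega

theorem leaving_unique (h : ColumnProfile n P b t) {p : ℤ × ℤ} {d d' : Step}
    (hd : IsBoundaryStep P p d) (hd' : IsBoundaryStep P p d') : d = d' := by
  obtain ⟨x, y⟩ := p
  have := h.no_pinch x y
  cases d <;> cases d' <;>
    simp only [isBoundaryStep_iff, Step.rightCell, Step.leftCell] at hd hd' <;>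
    first | rfl | (exfalso; tauto)

theorem arriving_unique (h : ColumnProfile n P b t) {p : ℤ × ℤ} {d d' : Step}
    (hd : IsBoundaryStep P (p - d.vec) d) (hd' : IsBoundaryStep P (p - d'.vec) d') : d = d' := by
  obtain ⟨x, y⟩ := p
  have := h.no_pinch x y
  cases d <;> cases d' <;>
    simp [isBoundaryStep_iff, Step.rightCell, Step.leftCell, Step.vec] at hd hd' <;>
    first | rfl | (exfalso; tauto)

/-- A lattice point is a vertex if and only if an odd number of the four cells around it belong to
`P`. -/
theorem isVertex_iff_odd (h : ColumnProfile n P b t) (x y : ℤ) :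
    IsVertex P (x, y) ↔
      ¬ (((x, y) ∈ P ↔ (x - 1, y) ∈ P) ↔ ((x, y - 1) ∈ P ↔ (x - 1, y - 1) ∈ P)) := by
  have hp := h.no_pinch x y
  constructor
  · rintro ⟨d, d', h1, h2, h3⟩
    cases d <;> cases d' <;>
      simp [isBoundaryStep_iff, Step.rightCell, Step.leftCell, Step.vec, Step.IsVertical]
        at h1 h2 h3 <;> tauto
  · clear hp
    intro hx
    have key : ∀ d d' : Step, IsBoundaryStep P ((x, y) - d.vec) d → IsBoundaryStep P (x, y) d' →
        (d.IsVertical ↔ ¬ d'.IsVertical) → IsVertex P (x, y) :=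
      fun d d' h1 h2 h3 => ⟨d, d', h1, h2, h3⟩
    have k1 := key .north .east
    have k2 := key .north .west
    have k3 := key .south .east
    have k4 := key .south .west
    have k5 := key .east .north
    have k6 := key .east .south
    have k7 := key .west .north
    have k8 := key .west .south
    simp [isBoundaryStep_iff, Step.rightCell, Step.leftCell, Step.vec, Step.IsVertical]
      at k1 k2 k3 k4 k5 k6 k7 k8
    clear key
    by_cases c1 : (x, y) ∈ P <;> by_cases c2 : (x - 1, y) ∈ P <;>
      by_cases c3 : (x, y - 1) ∈ P <;> by_cases c4 : (x - 1, y - 1) ∈ P <;> simp_all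

theorem isVertex_first (h : ColumnProfile n P b t) (hn : 2 ≤ n) (y : ℤ) :
    IsVertex P (1, y) ↔ y = b 1 ∨ y = t 1 := by
  rw [h.isVertex_iff_odd]
  have := h.lt 1 le_rfl (by omega)
  simp only [h.mem_iff]
  omega

theorem isVertex_last (h : ColumnProfile n P b t) (hn : 2 ≤ n) (y : ℤ) :
    IsVertex P (n, y) ↔ y = b (n - 1) ∨ y = t (n - 1) := by
  rw [h.isVertex_iff_odd]
  have := h.lt (n - 1) (by omega) (by omega)
  simp only [h.mem_iff]
  omega

theorem isVertex_inner (h : ColumnProfile n P b t) {x : ℤ} (hx : 1 ≤ x) (hx' : x + 1 < n) (y : ℤ) :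
    IsVertex P (x + 1, y) ↔ (b x ≠ b (x + 1) ∧ (y = b x ∨ y = b (x + 1))) ∨
      (t x ≠ t (x + 1) ∧ (y = t x ∨ y = t (x + 1))) := by
  rw [h.isVertex_iff_odd]
  have h1 := h.lt x hx (by omega)
  have h2 := h.lt (x + 1) (by omega) hx'
  have h3 := h.lt_succ x hx hx'
  have h4 := h.succ_lt x hx hx'
  simp only [h.mem_iff, add_sub_cancel_right]
  have e1 : (1 ≤ x + 1 ∧ x + 1 < n) = True := by simp; omega
  have e2 : (1 ≤ x ∧ x < n) = True := by simp; omega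
  simp only [e1, e2, true_and]
  omega

theorem not_isVertex (h : ColumnProfile n P b t) {x : ℤ} (hx : x < 1 ∨ n < x) (y : ℤ) :
    ¬ IsVertex P (x, y) := by
  rw [h.isVertex_iff_odd]
  simp only [h.mem_iff]
  omega

end ColumnProfile

/-! ### Admissible sets of positions -/

variable {n : ℕ}

/-- The first element of `U` after position `i` (junk value `i` if there is none). -/
def nxt (U : Finset (Fin n)) (i : Fin n) : Fin n :=
  if h : (U.filter (i < ·)).Nonempty then (U.filter (i < ·)).min' h else i

/-- The last position up to and including `i` that is not in `U` (junk value `i` if there is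
none). -/
def prv (U : Finset (Fin n)) (i : Fin n) : Fin n :=
  if h : (Uᶜ.filter (· ≤ i)).Nonempty then (Uᶜ.filter (· ≤ i)).max' h else i

theorem nxt_spec {U : Finset (Fin n)} {i c : Fin n} (hc : c ∈ U) (hic : i < c) :
    nxt U i ∈ U ∧ i < nxt U i ∧ ∀ j ∈ U, i < j → nxt U i ≤ j := by
  have h : (U.filter (i < ·)).Nonempty := ⟨c, by simp [hc, hic]⟩
  have h1 := Finset.min'_mem _ h
  rw [nxt, dif_pos h]
  rw [Finset.mem_filter] at h1
  exact ⟨h1.1, h1.2, fun j hj hij => Finset.min'_le _ _ (by simp [hj, hij])⟩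

theorem prv_spec {U : Finset (Fin n)} {i a : Fin n} (ha : a ∉ U) (hai : a ≤ i) :
    prv U i ∉ U ∧ prv U i ≤ i ∧ ∀ j ∉ U, j ≤ i → j ≤ prv U i := by
  have h : (Uᶜ.filter (· ≤ i)).Nonempty := ⟨a, by simp [ha, hai]⟩
  have h1 := Finset.max'_mem _ h
  rw [prv, dif_pos h]
  rw [Finset.mem_filter, Finset.mem_compl] at h1
  exact ⟨h1.1, h1.2, fun j hj hij => Finset.le_max' _ _ (by simp [hj, hij])⟩

theorem nxt_eq {U : Finset (Fin n)} {i c : Fin n} (hc : c ∈ U) (hic : i < c)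
    (h : ∀ j ∈ U, i < j → c ≤ j) : nxt U i = c :=
  le_antisymm ((nxt_spec hc hic).2.2 c hc hic) (h _ (nxt_spec hc hic).1 (nxt_spec hc hic).2.1)

theorem prv_eq {U : Finset (Fin n)} {i a : Fin n} (ha : a ∉ U) (hai : a ≤ i)
    (h : ∀ j ∉ U, j ≤ i → j ≤ a) : prv U i = a :=
  le_antisymm (h _ (prv_spec ha hai).1 (prv_spec ha hai).2.1) ((prv_spec ha hai).2.2 a ha hai)

/-- The first position is not in `U` and the last one is. -/
structure Anchored (U : Finset (Fin n)) : Prop where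
  first_notMem : ∀ i : Fin n, (i : ℕ) = 0 → i ∉ U
  last_mem : ∀ i : Fin n, (i : ℕ) + 1 = n → i ∈ U

/-- The sets `U` of positions that can occur as the set of abscissas at which the point of `π` lies
on the upper one of the two boundary paths joining the west side to the east side. In the column
between the positions `i` and `i + 1` the region lies between the ordinates of the points of `π` at
`prv U i` and `nxt U i`. -/
structure Admissible (π : Equiv.Perm (Fin n)) (U : Finset (Fin n)) : Prop extends Anchored U where
  sep : ∀ i : Fin n, (i : ℕ) + 1 < n → π (prv U i) < π (nxt U i)
  no_valley : ∀ a ∈ U, ∀ b ∈ U, ∀ c ∈ U, a < b → b < c → π b < π c → π a < π b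
  no_peak : ∀ a ∉ U, ∀ b ∉ U, ∀ c ∉ U, a < b → b < c → π c < π b → π b < π a

namespace Anchored

variable {U : Finset (Fin n)}

theorem nxt_spec (h : Anchored U) {i : Fin n} (hi : (i : ℕ) + 1 < n) :
    nxt U i ∈ U ∧ i < nxt U i ∧ ∀ j ∈ U, i < j → nxt U i ≤ j :=
  Permutomino.nxt_spec (c := ⟨n - 1, by omega⟩) (h.last_mem _ (by simp; omega))
    (Fin.lt_def.2 (by simp; omega))

theorem prv_spec (h : Anchored U) (i : Fin n) :
    prv U i ∉ U ∧ prv U i ≤ i ∧ ∀ j ∉ U, j ≤ i → j ≤ prv U i :=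
  Permutomino.prv_spec (a := ⟨0, i.pos⟩) (h.first_notMem _ rfl)
    (Fin.le_def.2 (by simp))

theorem pos_of_mem (h : Anchored U) {i : Fin n} (hi : i ∈ U) : 0 < (i : ℕ) := by
  by_contra hc
  exact h.first_notMem i (by omega) hi

theorem lt_of_notMem (h : Anchored U) {i : Fin n} (hi : i ∉ U) : (i : ℕ) + 1 < n := by
  by_contra hc
  exact hi (h.last_mem i (by omega))

end Anchored

namespace Admissible

variable {π : Equiv.Perm (Fin n)} {U : Finset (Fin n)}

theorem prv_lt_nxt_pred (h : Admissible π U) {i : Fin n} (hi : i ∈ U) :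
    ∃ a ∉ U, a < i ∧ (∀ j ∉ U, j < i → j ≤ a) ∧ π a < π i := by
  have hpos := h.pos_of_mem hi
  have hj : ((⟨i - 1, by omega⟩ : Fin n) : ℕ) + 1 < n := by simp; omega
  have hn : nxt U ⟨i - 1, by omega⟩ = i :=
    nxt_eq hi (Fin.lt_def.2 (by simp; omega)) fun j _ hlt => by
      rw [Fin.lt_def] at hlt
      rw [Fin.le_def]
      simp only at hlt
      omega
  obtain ⟨h1, h2, h3⟩ := h.prv_spec ⟨i - 1, by omega⟩
  have hs := h.sep _ hj
  rw [hn] at hs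
  refine ⟨_, h1, ?_, fun j hj hji => h3 j hj ?_, hs⟩
  · rw [Fin.le_def] at h2
    rw [Fin.lt_def]
    simp only at h2
    omega
  · rw [Fin.lt_def] at hji
    rw [Fin.le_def]
    simp only
    omega

theorem lt_nxt (h : Admissible π U) {i : Fin n} (hi : i ∉ U) : π i < π (nxt U i) := by
  have hs := h.sep i (h.lt_of_notMem hi)
  rwa [prv_eq hi le_rfl fun _ _ hj => hj] at hs

/-- An inner point on the upper path is either a reentrant corner facing north-west or a salient
corner facing north-east; the quadrant it faces contains no point of `π`. -/
theorem upper_dichotomy (h : Admissible π U) {i : Fin n} (hi : i ∈ U) (hin : (i : ℕ) + 1 < n) :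
    (∀ a < i, π a < π i) ∨ ∀ c > i, π c < π i := by
  obtain ⟨h1, h2, h3⟩ := h.nxt_spec hin
  rcases lt_or_gt_of_ne (π.injective.ne h2.ne) with hlt | hgt
  · left
    have key : ∀ a ∈ U, a < i → π a < π i := fun a ha hai => h.no_valley a ha i hi _ h1 hai h2 hlt
    intro a hai
    by_cases ha : a ∈ U
    · exact key a ha hai
    · have h4 := h.lt_nxt ha
      obtain ⟨h5, -, h6⟩ := h.nxt_spec (h.lt_of_notMem ha)
      rcases (h6 i hi hai).lt_or_eq with h7 | h7
      · exact h4.trans (key _ h5 h7)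
      · rwa [h7] at h4
  · right
    have key : ∀ c ∈ U, i < c → π c < π i := by
      intro c hc hic
      rcases (h3 c hc hic).lt_or_eq with h4 | h4
      · by_contra hcon
        rw [not_lt] at hcon
        exact lt_asymm hgt (h.no_valley i hi _ h1 c hc h2 h4 (hgt.trans_le hcon))
      · rwa [← h4]
    intro c hic
    by_cases hc : c ∈ U
    · exact key c hc hic
    · obtain ⟨h5, h6, -⟩ := h.nxt_spec (h.lt_of_notMem hc)
      exact (h.lt_nxt hc).trans (key _ h5 (hic.trans h6))

/-- An inner point on the lower path is either a reentrant corner facing south-east or a salient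
corner facing south-west; the quadrant it faces contains no point of `π`. -/
theorem lower_dichotomy (h : Admissible π U) {i : Fin n} (hi : i ∉ U) (hpos : 0 < (i : ℕ)) :
    (∀ c > i, π i < π c) ∨ ∀ a < i, π i < π a := by
  obtain ⟨h1, h2, h3⟩ := h.prv_spec ⟨i - 1, by omega⟩
  have h2 : prv U ⟨i - 1, by omega⟩ < i := by
    rw [Fin.le_def] at h2
    rw [Fin.lt_def]
    simp only at h2
    omega
  have h3 : ∀ j ∉ U, j < i → j ≤ prv U ⟨i - 1, by omega⟩ := fun j hj hji => h3 j hj (by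
    rw [Fin.lt_def] at hji
    rw [Fin.le_def]
    simp only
    omega)
  generalize prv U ⟨i - 1, by omega⟩ = p at h1 h2 h3
  rcases lt_or_gt_of_ne (π.injective.ne h2.ne) with hlt | hgt
  · left
    have key : ∀ c ∉ U, i < c → π i < π c := by
      intro c hc hic
      by_contra hcon
      have := lt_of_le_of_ne (not_lt.1 hcon) (π.injective.ne hic.ne')
      exact lt_asymm hlt (h.no_peak p h1 i hi c hc h2 hic this)
    intro c hic
    by_cases hc : c ∈ U
    · obtain ⟨a, ha, hac, hmax, hlt'⟩ := h.prv_lt_nxt_pred hc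
      rcases (hmax i hi hic).lt_or_eq with h4 | h4
      · exact (key a ha h4).trans hlt'
      · rwa [h4]
    · exact key c hc hic
  · right
    have key : ∀ a ∉ U, a < i → π i < π a := by
      intro a ha hai
      rcases (h3 a ha hai).lt_or_eq with h4 | h4
      · exact LT.lt.trans hgt (h.no_peak a ha p h1 i hi h4 h2 hgt)
      · rwa [h4]
    intro a hai
    by_cases ha : a ∈ U
    · obtain ⟨a', ha', haa, -, hlt'⟩ := h.prv_lt_nxt_pred ha
      exact (key a' ha' (haa.trans hai)).trans hlt'
    · exact key a ha hai

end Admissible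

/-! ### Free fixed points as cut points -/

theorem apply_eq_of_cut {π : Equiv.Perm (Fin n)} {i : Fin n} (hl : ∀ a < i, π a < π i)
    (hr : ∀ c > i, π i < π c) : π i = i := by
  apply le_antisymm
  · have := Finset.card_le_card_of_injOn (s := Finset.Ioi i) (t := Finset.Ioi (π i)) π
      (fun c hc => by simpa using hr c (by simpa using hc)) π.injective.injOn
    rw [Fin.card_Ioi, Fin.card_Ioi] at this
    rw [Fin.le_def]
    omega
  · have := Finset.card_le_card_of_injOn (s := Finset.Iio i) (t := Finset.Iio (π i)) π
      (fun c hc => by simpa using hl c (by simpa using hc)) π.injective.injOn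
    rwa [Fin.card_Iio, Fin.card_Iio] at this

/-- A free fixed point cuts `π` into a permutation of the smaller positions and a permutation of the
larger ones. -/
theorem mem_freeFixedPoints_iff {π : Equiv.Perm (Fin n)} {i : Fin n} :
    i ∈ freeFixedPoints π ↔ 0 < (i : ℕ) ∧ (i : ℕ) + 1 < n ∧ (∀ a < i, π a < π i) ∧
      ∀ c > i, π i < π c := by
  constructor
  · rintro ⟨hfix, ⟨hmu, hle⟩, h0, hn⟩
    have hin : (i : ℕ) + 1 < n := by omega
    have hl : ∀ a < i, π a < π i := by
      rcases hmu with hmu | hmu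
      · exact hmu
      · exfalso
        have hj : (π (π.symm ⟨n - 1, by omega⟩) : ℕ) = n - 1 := by simp
        have h1 := hle (π.symm ⟨n - 1, by omega⟩) (by omega)
        rcases h1.lt_or_eq with h2 | h2
        · have h3 := hmu _ h2
          rw [Fin.lt_def] at h3
          omega
        · rw [← h2, hfix] at hj
          omega
    refine ⟨by omega, hin, hl, fun c hc => ?_⟩
    have him : (Finset.Iio i).image π = Finset.Iio i := by
      apply Finset.eq_of_subset_of_card_le
      · intro y hy
        obtain ⟨a, ha, rfl⟩ := Finset.mem_image.1 hy
        rw [Finset.mem_Iio] at ha ⊢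
        exact (hl a ha).trans_eq hfix
      · rw [Finset.card_image_of_injective _ π.injective]
    by_contra hcon
    have h1 : π c < i := lt_of_lt_of_eq
      (lt_of_le_of_ne (not_lt.1 hcon) (π.injective.ne hc.ne')) hfix
    rw [← Finset.mem_Iio, ← him, Finset.mem_image] at h1
    obtain ⟨a, ha, hac⟩ := h1
    rw [Finset.mem_Iio, π.injective hac] at ha
    exact lt_asymm ha hc
  · rintro ⟨h0, hn, hl, hr⟩
    refine ⟨apply_eq_of_cut hl hr, ⟨Or.inl hl, fun j hj => ?_⟩, by omega, by omega⟩
    by_contra hc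
    have := hl j (not_le.1 hc)
    rw [Fin.lt_def] at this
    omega

namespace Admissible

variable {π : Equiv.Perm (Fin n)} {U V : Finset (Fin n)}

/-- Two admissible sets of positions differ only in free fixed points. -/
theorem mem_freeFixedPoints (hU : Admissible π U) (hV : Admissible π V) {i : Fin n} (hi : i ∈ U)
    (hi' : i ∉ V) : i ∈ freeFixedPoints π := by
  have hpos := hU.pos_of_mem hi
  have hin := hV.lt_of_notMem hi'
  rw [mem_freeFixedPoints_iff]
  refine ⟨hpos, hin, ?_, ?_⟩
  · refine (hU.upper_dichotomy hi hin).resolve_right fun hc => ?_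
    exact lt_asymm (hc _ (hV.nxt_spec hin).2.1) (hV.lt_nxt hi')
  · refine (hV.lower_dichotomy hi' hpos).resolve_right fun hc => ?_
    obtain ⟨a, -, hai, -, hlt⟩ := hU.prv_lt_nxt_pred hi
    exact lt_asymm (hc a hai) hlt

theorem insert_of_free (h : Admissible π U) {i : Fin n} (hi : i ∈ freeFixedPoints π) :
    Admissible π (insert i U) := by
  obtain ⟨hpos, hin, hl, hr⟩ := mem_freeFixedPoints_iff.1 hi
  have hnot : ∀ {j}, j ∉ insert i U → j ∉ U ∧ j ≠ i := fun hj => by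
    rw [Finset.mem_insert, not_or] at hj
    exact ⟨hj.2, hj.1⟩
  have hlast : (⟨n - 1, by omega⟩ : Fin n) ∈ U := h.last_mem _ (by simp; omega)
  have hfirst : (⟨0, by omega⟩ : Fin n) ∉ insert i U := by
    rw [Finset.mem_insert, not_or]
    exact ⟨fun hc => by rw [← hc] at hpos; simp at hpos, h.first_notMem _ rfl⟩
  refine ⟨⟨fun j hj hjU => ?_, fun j hj => Finset.mem_insert_of_mem (h.last_mem j hj)⟩, ?_, ?_, ?_⟩
  · rcases Finset.mem_insert.1 hjU with rfl | hjU
    · omega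
    · exact h.first_notMem j hj hjU
  · intro x hx
    have hs := h.sep x hx
    obtain ⟨h1, h2, h3⟩ := h.nxt_spec hx
    obtain ⟨h4, h5, h6⟩ := h.prv_spec x
    obtain ⟨h1', h2', h3'⟩ := Permutomino.nxt_spec (Finset.mem_insert_of_mem (b := i) h1) h2
    obtain ⟨h4', h5', h6'⟩ := Permutomino.prv_spec (i := x) hfirst (Fin.le_def.2 (by simp))
    rcases lt_or_ge x i with hxi | hxi
    · have hp : prv (insert i U) x = prv U x :=
        prv_eq (by rw [Finset.mem_insert, not_or]; exact ⟨(h5.trans_lt hxi).ne, h4⟩) h5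
          fun j hj => h6 j (hnot hj).1
      rw [hp]
      rcases Finset.mem_insert.1 h1' with h7 | h7
      · rw [h7]
        exact hl _ (h5.trans_lt hxi)
      · rwa [le_antisymm (h3' _ (Finset.mem_insert_of_mem h1) h2) (h3 _ h7 h2')]
    · have hq : nxt (insert i U) x = nxt U x := by
        refine nxt_eq (Finset.mem_insert_of_mem h1) h2 fun j hj hxj => h3 j ?_ hxj
        exact (Finset.mem_insert.1 hj).resolve_left (hxi.trans_lt hxj).ne'
      rw [hq]
      by_cases h7 : prv U x = i
      · have h8 : prv (insert i U) x < i := by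
          refine lt_of_le_of_ne ?_ (hnot h4').2
          exact (h6 _ (hnot h4').1 h5').trans_eq h7
        exact (hl _ h8).trans (h7 ▸ hs)
      · rwa [prv_eq (by rw [Finset.mem_insert, not_or]; exact ⟨h7, h4⟩) h5
          fun j hj => h6 j (hnot hj).1]
  · intro a ha b hb c hc hab hbc hlt
    rcases Finset.mem_insert.1 hb with rfl | hb'
    · exact hl a hab
    rcases Finset.mem_insert.1 ha with rfl | ha'
    · exact hr b hab
    rcases Finset.mem_insert.1 hc with rfl | hc'
    · -- the last position can take the place of `c`
      have hcn : c < ⟨n - 1, by omega⟩ := Fin.lt_def.2 (by simp; omega)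
      exact h.no_valley a ha' b hb' _ hlast hab (hbc.trans hcn) (hlt.trans (hr _ hcn))
    · exact h.no_valley a ha' b hb' c hc' hab hbc hlt
  · intro a ha b hb c hc
    exact h.no_peak a (hnot ha).1 b (hnot hb).1 c (hnot hc).1

theorem erase_of_free (h : Admissible π U) {i : Fin n} (hi : i ∈ freeFixedPoints π) :
    Admissible π (U.erase i) := by
  obtain ⟨hpos, hin, hl, hr⟩ := mem_freeFixedPoints_iff.1 hi
  have hnot : ∀ {j}, j ∉ U.erase i ↔ j = i ∨ j ∉ U := fun {j} => by
    rw [Finset.mem_erase]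
    tauto
  have hfirst : (⟨0, by omega⟩ : Fin n) ∉ U := h.first_notMem _ rfl
  have hlast : (⟨n - 1, by omega⟩ : Fin n) ∈ U.erase i := by
    rw [Finset.mem_erase]
    exact ⟨fun hc => by rw [← hc] at hin; simp at hin; omega, h.last_mem _ (by simp; omega)⟩
  refine ⟨⟨fun j hj => hnot.2 (Or.inr (h.first_notMem j hj)), fun j hj => ?_⟩, ?_, ?_, ?_⟩
  · rw [Finset.mem_erase]
    exact ⟨fun hc => by rw [hc] at hj; omega, h.last_mem j hj⟩
  · intro x hx
    have hs := h.sep x hx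
    obtain ⟨h1, h2, h3⟩ := h.nxt_spec hx
    obtain ⟨h4, h5, h6⟩ := h.prv_spec x
    obtain ⟨h1', h2', h3'⟩ := Permutomino.nxt_spec (i := x) hlast (Fin.lt_def.2 (by simp; omega))
    obtain ⟨h4', h5', h6'⟩ := Permutomino.prv_spec (hnot.2 (Or.inr h4)) h5
    rcases lt_or_ge x i with hxi | hxi
    · have hp : prv (U.erase i) x = prv U x :=
        prv_eq (hnot.2 (Or.inr h4)) h5 fun j hj hjx =>
          h6 j ((hnot.1 hj).resolve_left (hjx.trans_lt hxi).ne) hjx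
      rw [hp]
      by_cases h7 : nxt U x = i
      · have h8 : i < nxt (U.erase i) x := by
          refine lt_of_le_of_ne ?_ (Finset.ne_of_mem_erase h1').symm
          exact h7.symm.trans_le (h3 _ (Finset.mem_of_mem_erase h1') h2')
        exact (h7 ▸ hs).trans (hr _ h8)
      · rwa [nxt_eq (Finset.mem_erase.2 ⟨h7, h1⟩) h2
          fun j hj => h3 j (Finset.mem_of_mem_erase hj)]
    · have hq : nxt (U.erase i) x = nxt U x :=
        nxt_eq (Finset.mem_erase.2 ⟨(hxi.trans_lt h2).ne', h1⟩) h2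
          fun j hj => h3 j (Finset.mem_of_mem_erase hj)
      rw [hq]
      rcases hnot.1 h4' with h7 | h7
      · rw [h7]
        exact hr _ (hxi.trans_lt h2)
      · rwa [le_antisymm (h6 _ h7 h5') (h6' _ (hnot.2 (Or.inr h4)) h5)]
  · intro a ha b hb c hc
    exact h.no_valley a (Finset.mem_of_mem_erase ha) b (Finset.mem_of_mem_erase hb) c
      (Finset.mem_of_mem_erase hc)
  · intro a ha b hb c hc hab hbc hlt
    rcases hnot.1 hb with rfl | hb'
    · exact absurd (hr c hbc) hlt.not_gt
    rcases hnot.1 hc with rfl | hc'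
    · exact absurd (hl b hbc) hlt.not_gt
    rcases hnot.1 ha with rfl | ha'
    · -- the first position can take the place of `a`
      have han : ⟨0, by omega⟩ < a := Fin.lt_def.2 (by simp; omega)
      exact (h.no_peak _ hfirst b hb' c hc' (han.trans hab) hbc hlt).trans (hl _ han)
    · exact h.no_peak a ha' b hb' c hc' hab hbc hlt

theorem union_of_free (h : Admissible π U) {S : Finset (Fin n)}
    (hS : ∀ i ∈ S, i ∈ freeFixedPoints π) : Admissible π (S ∪ U) := by
  induction S using Finset.induction_on with
  | empty => simpa using h
  | insert i S _ ih =>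
    rw [Finset.insert_union]
    exact (ih fun j hj => hS j (Finset.mem_insert_of_mem hj)).insert_of_free
      (hS i (Finset.mem_insert_self i S))

theorem sdiff_of_free (h : Admissible π U) {S : Finset (Fin n)}
    (hS : ∀ i ∈ S, i ∈ freeFixedPoints π) : Admissible π (U \ S) := by
  induction S using Finset.induction_on with
  | empty => simpa using h
  | insert i S _ ih =>
    rw [Finset.sdiff_insert]
    exact (ih fun j hj => hS j (Finset.mem_insert_of_mem hj)).erase_of_free
      (hS i (Finset.mem_insert_self i S))

/-- If there is an admissible set at all, then the admissible sets are obtained from it by choosing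
freely which free fixed points to include. -/
theorem ncard_setOf (h : Admissible π U) :
    {V | Admissible π V}.ncard = 2 ^ (freeFixedPoints π).ncard := by
  classical
  have hfin : (freeFixedPoints π).Finite := Set.toFinite _
  set F := hfin.toFinset with hF
  have hmemF : ∀ i, i ∈ F ↔ i ∈ freeFixedPoints π := fun i => hfin.mem_toFinset
  have himage : {V | Admissible π V} =
      (F.powerset.image (· ∪ U \ F) : Finset (Finset (Fin n))) := by
    ext V
    rw [Finset.mem_coe, Finset.mem_image]
    constructor
    · intro hV
      refine ⟨V ∩ F, Finset.mem_powerset.2 Finset.inter_subset_right, ?_⟩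
      ext i
      have h1 : i ∈ U → i ∉ V → i ∈ F := fun a b => (hmemF i).2 (h.mem_freeFixedPoints hV a b)
      have h2 : i ∈ V → i ∉ U → i ∈ F := fun a b =>
        (hmemF i).2 (Admissible.mem_freeFixedPoints hV h a b)
      simp only [Finset.mem_union, Finset.mem_inter, Finset.mem_sdiff]
      tauto
    · rintro ⟨S, hS, rfl⟩
      rw [Finset.mem_powerset] at hS
      exact (h.sdiff_of_free fun i hi => (hmemF i).1 hi).union_of_free
        fun i hi => (hmemF i).1 (hS hi)
  rw [himage, Set.ncard_coe_finset, Finset.card_image_of_injOn, Finset.card_powerset,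
    Set.ncard_eq_toFinset_card _ hfin]
  intro S hS T hT hST
  rw [Finset.coe_powerset, Set.mem_preimage, Set.mem_powerset_iff, Finset.coe_subset] at hS hT
  ext i
  have h1 := @hS i
  have h2 := @hT i
  have h3 := Finset.ext_iff.1 hST i
  simp only [Finset.mem_union, Finset.mem_sdiff] at h3
  tauto

end Admissible

/-! ### The traversal of the positions -/

/-- The boundary, traversed clockwise, visits the points of `π` in the following cyclic order of
positions: from the first position along `U` in increasing order to the last position, and back
along the complement of `U` in decreasing order. This is the successor function of that order. -/
def rot (U : Finset (Fin n)) (i : Fin n) : Fin n :=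
  if (i : ℕ) + 1 < n ∧ (i ∈ U ∨ (i : ℕ) = 0) then nxt U i else prv U ⟨i - 1, by omega⟩

namespace Anchored

variable {U : Finset (Fin n)}

theorem rot_cases (h : Anchored U) (hn : 2 ≤ n) (i : Fin n) :
    ((i : ℕ) + 1 < n ∧ (i ∈ U ∨ (i : ℕ) = 0) ∧ rot U i = nxt U i ∧ rot U i ∈ U ∧ i < rot U i ∧
      ∀ j ∈ U, i < j → rot U i ≤ j) ∨
    (0 < (i : ℕ) ∧ ((i : ℕ) + 1 = n ∨ i ∉ U) ∧ rot U i = prv U ⟨i - 1, by omega⟩ ∧ rot U i ∉ U ∧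
      rot U i < i ∧ ∀ j ∉ U, j < i → j ≤ rot U i) := by
  by_cases hc : (i : ℕ) + 1 < n ∧ (i ∈ U ∨ (i : ℕ) = 0)
  · left
    rw [rot, if_pos hc]
    exact ⟨hc.1, hc.2, rfl, h.nxt_spec hc.1⟩
  · right
    have hpos : 0 < (i : ℕ) := by omega
    rw [rot, if_neg hc]
    obtain ⟨h1, h2, h3⟩ := h.prv_spec ⟨i - 1, by omega⟩
    refine ⟨hpos, ?_, rfl, h1, ?_, fun j hj hji => h3 j hj ?_⟩
    · by_cases hi : i ∈ U
      · exact Or.inl (by have := i.isLt; by_contra; exact hc ⟨by omega, Or.inl hi⟩)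
      · exact Or.inr hi
    · rw [Fin.le_def] at h2
      rw [Fin.lt_def]
      simp only at h2
      omega
    · rw [Fin.lt_def] at hji
      rw [Fin.le_def]
      simp only
      omega

theorem rot_ne (h : Anchored U) (hn : 2 ≤ n) (i : Fin n) : rot U i ≠ i := by
  rcases h.rot_cases hn i with h1 | h1
  · exact h1.2.2.2.2.1.ne'
  · exact h1.2.2.2.2.1.ne

theorem rot_injective (h : Anchored U) (hn : 2 ≤ n) : Function.Injective (rot U) := by
  have key : ∀ i j, i < j → rot U i ≠ rot U j := by
    intro i j hij heq
    rcases h.rot_cases hn i with ⟨h1, h2, -, h3, h4, h5⟩ | ⟨h1, h2, -, h3, h4, h5⟩ <;>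
      rcases h.rot_cases hn j with ⟨h1', h2', -, h3', h4', h5'⟩ | ⟨h1', h2', -, h3', h4', h5'⟩
    · rw [Fin.lt_def] at hij
      have h6 := h5 j (h2'.resolve_right (by omega)) hij
      rw [heq] at h6
      exact absurd h4' h6.not_gt
    · exact h3' (heq ▸ h3)
    · exact h3 (heq ▸ h3')
    · rw [Fin.lt_def] at hij
      have h6 := h5' i (h2.resolve_left (by omega)) hij
      rw [← heq] at h6
      exact absurd h4 h6.not_gt
  intro i j hij
  by_contra hne
  rcases lt_or_gt_of_ne hne with h1 | h1
  · exact key i j h1 hij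
  · exact key j i h1 hij.symm

/-- The function `rot U` as a permutation. -/
noncomputable def rotPerm (h : Anchored U) (hn : 2 ≤ n) : Equiv.Perm (Fin n) :=
  Equiv.ofBijective (rot U) (Finite.injective_iff_bijective.1 (h.rot_injective hn))

theorem rotPerm_isCycleOn (h : Anchored U) (hn : 2 ≤ n) :
    (h.rotPerm hn).IsCycleOn ((Finset.univ : Finset (Fin n)) : Set (Fin n)) := by
  have hsymm : ∀ i, rot U ((h.rotPerm hn).symm i) = i := fun i =>
    (h.rotPerm hn).apply_symm_apply i
  -- going backwards from an element of `U` leads down to the first position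
  have hup : ∀ k : ℕ, ∀ i : Fin n, (i : ℕ) = k → i ∈ U ∨ (i : ℕ) = 0 →
      (h.rotPerm hn).SameCycle ⟨0, by omega⟩ i := by
    intro k
    induction k using Nat.strong_induction_on with
    | _ k ih =>
      rintro i rfl hi
      rcases hi with hi | hi
      · obtain ⟨p, rfl⟩ : ∃ p, rot U p = i := ⟨_, hsymm i⟩
        rcases h.rot_cases hn p with ⟨-, h1, -, -, h2, -⟩ | ⟨-, -, -, h1, -⟩
        · exact Equiv.Perm.sameCycle_apply_right.2 (ih p h2 p rfl h1)
        · exact absurd hi h1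
      · rw [show i = ⟨0, by omega⟩ from Fin.ext hi]
  -- going backwards from any other position leads up to the last position
  have hdown : ∀ k : ℕ, ∀ i : Fin n, n - i = k → i ∉ U →
      (h.rotPerm hn).SameCycle ⟨0, by omega⟩ i := by
    intro k
    induction k using Nat.strong_induction_on with
    | _ k ih =>
      rintro i rfl hi
      obtain ⟨p, rfl⟩ : ∃ p, rot U p = i := ⟨_, hsymm i⟩
      rcases h.rot_cases hn p with ⟨-, -, -, h1, -⟩ | ⟨-, -, -, -, h2, -⟩
      · exact absurd h1 hi
      · refine Equiv.Perm.sameCycle_apply_right.2 ?_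
        by_cases hp : p ∈ U
        · exact hup _ p rfl (Or.inl hp)
        · exact ih (n - p) (by rw [Fin.lt_def] at h2; omega) p rfl hp
  have hall : ∀ i, (h.rotPerm hn).SameCycle ⟨0, by omega⟩ i := fun i => by
    by_cases hi : i ∈ U
    · exact hup _ i rfl (Or.inl hi)
    · exact hdown _ i rfl hi
  rw [Finset.coe_univ]
  exact ⟨Set.bijOn_univ.2 (h.rotPerm hn).bijective, fun i _ j _ => (hall i).symm.trans (hall j)⟩

end Anchored

/-! ### Profiles encoded by a permutation and a set of positions -/

/-- The region `P` has the column profile `b`, `t`. At the abscissa of a position in `U` only the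
top changes, starting from the point of `π`; at the abscissa of any other position only the bottom
changes, ending at the point of `π`. Position `i` has abscissa `i + 1`, so it separates the columns
`i` and `i + 1`. -/
structure Encodes (π : Equiv.Perm (Fin n)) (U : Finset (Fin n)) (P : Finset (ℤ × ℤ))
    (b t : ℤ → ℤ) : Prop extends Anchored U where
  profile : ColumnProfile n P b t
  top_eq : ∀ i ∈ U, t (i : ℕ) = (π i : ℕ) + 1
  bot_eq : ∀ i ∉ U, b ((i : ℕ) + 1) = (π i : ℕ) + 1
  bot_succ : ∀ i ∈ U, (i : ℕ) + 1 < n → b ((i : ℕ) + 1) = b (i : ℕ)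
  top_succ : ∀ i ∉ U, 0 < (i : ℕ) → t ((i : ℕ) + 1) = t (i : ℕ)

theorem isClockwiseSide_north {P : Finset (ℤ × ℤ)} {x y y' : ℤ} (hy : y < y')
    (h : ∀ z, y ≤ z → z < y' → (x, z) ∈ P ∧ (x - 1, z) ∉ P) : IsClockwiseSide P (x, y) (x, y') := by
  refine ⟨.north, (y' - y).toNat, by omega, ?_, fun j hj => ?_⟩
  · ext <;> simp [Step.vec]; omega
  · have := h (y + j) (by omega) (by omega)
    simpa [isBoundaryStep_iff, Step.rightCell, Step.leftCell, Step.vec] using this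

theorem isClockwiseSide_south {P : Finset (ℤ × ℤ)} {x y y' : ℤ} (hy : y' < y)
    (h : ∀ z, y' ≤ z → z < y → (x - 1, z) ∈ P ∧ (x, z) ∉ P) : IsClockwiseSide P (x, y) (x, y') := by
  refine ⟨.south, (y - y').toNat, by omega, ?_, fun j hj => ?_⟩
  · ext <;> simp [Step.vec]; omega
  · have := h (y - j - 1) (by omega) (by omega)
    simpa [isBoundaryStep_iff, Step.rightCell, Step.leftCell, Step.vec, ← sub_eq_add_neg] using this

theorem isClockwiseSide_east {P : Finset (ℤ × ℤ)} {x x' y : ℤ} (hx : x < x')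
    (h : ∀ z, x ≤ z → z < x' → (z, y - 1) ∈ P ∧ (z, y) ∉ P) : IsClockwiseSide P (x, y) (x', y) := by
  refine ⟨.east, (x' - x).toNat, by omega, ?_, fun j hj => ?_⟩
  · ext <;> simp [Step.vec]; omega
  · have := h (x + j) (by omega) (by omega)
    simpa [isBoundaryStep_iff, Step.rightCell, Step.leftCell, Step.vec] using this

theorem isClockwiseSide_west {P : Finset (ℤ × ℤ)} {x x' y : ℤ} (hx : x' < x)
    (h : ∀ z, x' ≤ z → z < x → (z, y) ∈ P ∧ (z, y - 1) ∉ P) : IsClockwiseSide P (x, y) (x', y) := by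
  refine ⟨.west, (x - x').toNat, by omega, ?_, fun j hj => ?_⟩
  · ext <;> simp [Step.vec]; omega
  · have := h (x - j - 1) (by omega) (by omega)
    simpa [isBoundaryStep_iff, Step.rightCell, Step.leftCell, Step.vec, ← sub_eq_add_neg] using this

namespace Encodes

variable {π : Equiv.Perm (Fin n)} {U : Finset (Fin n)} {P : Finset (ℤ × ℤ)} {b t : ℤ → ℤ}

/-- The top is constant up to the next position in `U`. -/
theorem top_const (h : Encodes π U P b t) {i : Fin n} (hi : (i : ℕ) + 1 < n) {k : ℕ}
    (hk : (i : ℕ) + 1 ≤ k) (hk' : k ≤ nxt U i) : t k = (π (nxt U i) : ℕ) + 1 := by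
  obtain ⟨h1, h2, h3⟩ := h.nxt_spec hi
  rw [← h.top_eq _ h1]
  induction hk' using Nat.decreasingInduction with
  | self => rfl
  | of_succ m hm ih =>
    have hlt : m < n := hm.trans (nxt U i).isLt
    rw [← ih (by omega)]
    have hmU : (⟨m, hlt⟩ : Fin n) ∉ U := fun hmem => by
      have := h3 _ hmem (Fin.lt_def.2 hk)
      rw [Fin.le_def] at this
      simp only at this
      omega
    have := h.top_succ _ hmU (by simp only; omega)
    push_cast
    exact this.symm

/-- The bottom has been constant since the last position not in `U`. -/
theorem bot_const (h : Encodes π U P b t) {i : Fin n} (hi : (i : ℕ) + 1 < n) {k : ℕ}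
    (hk : (prv U i : ℕ) ≤ k) (hk' : k ≤ (i : ℕ)) : b (k + 1) = (π (prv U i) : ℕ) + 1 := by
  obtain ⟨h1, h2, h3⟩ := h.prv_spec i
  rw [← h.bot_eq _ h1]
  induction k, hk using Nat.le_induction with
  | base => rfl
  | succ m hm ih =>
    rw [← ih (by omega)]
    have hmU : (⟨m + 1, by omega⟩ : Fin n) ∈ U := by
      by_contra hmem
      have := h3 _ hmem (Fin.le_def.2 hk')
      rw [Fin.le_def] at this
      simp only at this
      omega
    have := h.bot_succ _ hmU (by simp only; omega)
    push_cast at this ⊢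
    exact this

theorem top_apply (h : Encodes π U P b t) {i : Fin n} (hi : (i : ℕ) + 1 < n) :
    t ((i : ℕ) + 1) = (π (nxt U i) : ℕ) + 1 := by
  have := h.top_const hi le_rfl (Fin.lt_def.1 (h.nxt_spec hi).2.1)
  push_cast at this
  exact this

theorem bot_apply (h : Encodes π U P b t) {i : Fin n} (hi : (i : ℕ) + 1 < n) :
    b ((i : ℕ) + 1) = (π (prv U i) : ℕ) + 1 :=
  h.bot_const hi (Fin.le_def.1 (h.prv_spec i).2.1) le_rfl

theorem bot_apply_pred (h : Encodes π U P b t) {i : Fin n} (hi : 0 < (i : ℕ)) :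
    b (i : ℕ) = (π (prv U ⟨i - 1, by omega⟩) : ℕ) + 1 := by
  have := h.bot_apply (i := ⟨i - 1, by omega⟩) (by simp only; omega)
  rw [← this]
  congr 1
  simp only
  omega

theorem mem_range (h : Encodes π U P b t) {x : ℤ} (hx : 1 ≤ x) (hx' : x < n) :
    1 ≤ b x ∧ t x ≤ n := by
  obtain ⟨i, hi, rfl⟩ : ∃ i : Fin n, (i : ℕ) + 1 < n ∧ x = (i : ℕ) + 1 :=
    ⟨⟨(x - 1).toNat, by omega⟩, by simp only; omega, by simp only; omega⟩
  rw [h.top_apply hi, h.bot_apply hi]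
  omega

/-- The side of `P` that leaves the point of `π` at position `i`. -/
theorem vertical_side (h : Encodes π U P b t) (hn : 2 ≤ n) (i : Fin n) :
    IsClockwiseSide P ((i : ℕ) + 1, (π i : ℕ) + 1) ((i : ℕ) + 1, (π (rot U i) : ℕ) + 1) := by
  have hne : (π (rot U i) : ℕ) ≠ π i := fun hc => h.rot_ne hn i (π.injective (Fin.ext hc))
  have hlt := fun x h1 h2 => h.profile.lt x h1 h2
  have hcol : ∀ x y, (x, y) ∈ P ↔ (1 ≤ x ∧ x < n) ∧ b x ≤ y ∧ y < t x := h.profile.mem_iff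
  rcases h.rot_cases hn i with ⟨h1, h2, h3, -⟩ | ⟨h1, h2, h3, -⟩
  · rw [h3] at hne ⊢
    have ht := h.top_apply h1
    have hl1 := hlt ((i : ℕ) + 1) (by omega) (by omega)
    by_cases h0 : (i : ℕ) = 0
    · have hb := h.bot_eq i (h.first_notMem i h0)
      refine isClockwiseSide_north (by omega) fun z hz hz' => ?_
      rw [hcol, hcol]
      omega
    · have hiU := h2.resolve_right h0
      have hb := h.bot_succ i hiU h1
      have ht' := h.top_eq i hiU
      have hl2 := hlt (i : ℕ) (by omega) (by omega)
      rcases lt_or_gt_of_ne hne with hlt | hgt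
      · refine isClockwiseSide_south (by omega) fun z hz hz' => ?_
        rw [hcol, hcol, add_sub_cancel_right]
        omega
      · refine isClockwiseSide_north (by omega) fun z hz hz' => ?_
        rw [hcol, hcol, add_sub_cancel_right]
        omega
  · rw [h3] at hne ⊢
    have hb := h.bot_apply_pred h1
    have hl1 := hlt (i : ℕ) (by omega) (by omega)
    by_cases hl : (i : ℕ) + 1 = n
    · have ht := h.top_eq i (h.last_mem i hl)
      refine isClockwiseSide_south (by omega) fun z hz hz' => ?_
      rw [hcol, hcol, add_sub_cancel_right]
      omega
    · have hiU := h2.resolve_left hl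
      have ht := h.top_succ i hiU h1
      have hb' := h.bot_eq i hiU
      have hl2 := hlt ((i : ℕ) + 1) (by omega) (by omega)
      rcases lt_or_gt_of_ne hne with hlt | hgt
      · refine isClockwiseSide_south (by omega) fun z hz hz' => ?_
        rw [hcol, hcol, add_sub_cancel_right]
        omega
      · refine isClockwiseSide_north (by omega) fun z hz hz' => ?_
        rw [hcol, hcol, add_sub_cancel_right]
        omega

/-- The side of `P` that arrives at the point of `π` at position `rot U i`. -/
theorem horizontal_side (h : Encodes π U P b t) (hn : 2 ≤ n) (i : Fin n) :
    IsClockwiseSide P ((i : ℕ) + 1, (π (rot U i) : ℕ) + 1)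
      ((rot U i : ℕ) + 1, (π (rot U i) : ℕ) + 1) := by
  have hcol : ∀ x y, (x, y) ∈ P ↔ (1 ≤ x ∧ x < n) ∧ b x ≤ y ∧ y < t x := h.profile.mem_iff
  rcases h.rot_cases hn i with ⟨h1, h2, h3, -, h4, -⟩ | ⟨h1, h2, h3, -, h4, -⟩
  · rw [h3] at h4 ⊢
    rw [Fin.lt_def] at h4
    refine isClockwiseSide_east (by omega) fun z hz hz' => ?_
    obtain ⟨k, rfl⟩ := Int.eq_ofNat_of_zero_le (show 0 ≤ z by omega)
    have ht := h.top_const h1 (k := k) (by omega) (by omega)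
    have := h.profile.lt k (by omega) (by omega)
    rw [hcol, hcol]
    omega
  · rw [h3] at h4 ⊢
    rw [Fin.lt_def] at h4
    refine isClockwiseSide_west (by omega) fun z hz hz' => ?_
    obtain ⟨k, rfl⟩ : ∃ k : ℕ, z = k + 1 := ⟨(z - 1).toNat, by omega⟩
    have hb := h.bot_const (i := ⟨i - 1, by omega⟩) (by simp only; omega) (k := k) (by omega)
      (by simp only; omega)
    have := h.profile.lt (k + 1) (by omega) (by omega)
    rw [hcol, hcol]
    omega

theorem isVertex_iff (h : Encodes π U P b t) (hn : 2 ≤ n) (i : Fin n) (y : ℤ) :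
    IsVertex P ((i : ℕ) + 1, y) ↔ y = (π i : ℕ) + 1 ∨ y = (π (rot U i) : ℕ) + 1 := by
  have hne : (π (rot U i) : ℕ) ≠ π i := fun hc => h.rot_ne hn i (π.injective (Fin.ext hc))
  rcases h.rot_cases hn i with ⟨h1, h2, h3, -⟩ | ⟨h1, h2, h3, -⟩
  · rw [h3] at hne ⊢
    have ht := h.top_apply h1
    by_cases h0 : (i : ℕ) = 0
    · have hb := h.bot_eq i (h.first_notMem i h0)
      have := h.profile.isVertex_first (by omega) y
      rw [h0] at hb ht ⊢
      simp only [Nat.cast_zero, zero_add] at hb ht ⊢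
      rw [this, hb, ht]
    · have hiU := h2.resolve_right h0
      rw [h.profile.isVertex_inner (by omega) (by omega), h.bot_succ i hiU h1, ht, h.top_eq i hiU]
      omega
  · rw [h3] at hne ⊢
    have hb := h.bot_apply_pred h1
    by_cases hl : (i : ℕ) + 1 = n
    · have ht := h.top_eq i (h.last_mem i hl)
      have := h.profile.isVertex_last (by omega) y
      rw [show (n : ℤ) = (i : ℕ) + 1 by omega, add_sub_cancel_right, hb, ht] at this
      rw [this, or_comm]
    · have hiU := h2.resolve_left hl
      rw [h.profile.isVertex_inner (by omega) (by omega), h.top_succ i hiU h1, hb, h.bot_eq i hiU]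
      omega

/-- The point of `π` in the lowest row lies on the lower path. -/
theorem notMem_of_apply_eq_zero (h : Encodes π U P b t) {i : Fin n} (hi : (π i : ℕ) = 0) :
    i ∉ U := by
  intro hiU
  have hpos := h.pos_of_mem hiU
  have h1 := h.profile.lt (i : ℕ) (by omega) (by omega)
  have h2 := h.mem_range (x := (i : ℕ)) (by omega) (by omega)
  have h3 := h.top_eq i hiU
  omega

/-- The point of `π` in the highest row lies on the upper path. -/
theorem mem_of_apply_add_one_eq (h : Encodes π U P b t) {i : Fin n} (hi : (π i : ℕ) + 1 = n) :
    i ∈ U := by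
  by_contra hiU
  have hlt := h.lt_of_notMem hiU
  have h1 := h.profile.lt ((i : ℕ) + 1) (by omega) (by omega)
  have h2 := h.mem_range (x := (i : ℕ) + 1) (by omega) (by omega)
  have h3 := h.bot_eq i hiU
  omega

end Encodes

/-! ### From admissible sets to convex permutominoes -/

theorem coe_finRotate_eq_mod (m : ℕ) (j : Fin m) : (finRotate m j : ℕ) = (j + 1) % m := by
  cases m with
  | zero => exact j.elim0
  | succ m =>
    rw [finRotate_apply, Fin.val_add_one]
    split_ifs with h
    · simp [h]
    · have : (j : ℕ) ≠ m := fun hc => h (Fin.ext hc)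
      rw [Nat.mod_eq_of_lt (by omega)]

namespace Encodes

variable {π : Equiv.Perm (Fin n)} {U : Finset (Fin n)} {P : Finset (ℤ × ℤ)} {b t : ℤ → ℤ}

theorem isVertex_iff_exists (h : Encodes π U P b t) (hn : 2 ≤ n) (p : ℤ × ℤ) :
    IsVertex P p ↔ ∃ i : Fin n, p = (((i : ℕ) : ℤ) + 1, ((π i : ℕ) : ℤ) + 1) ∨
      p = (((i : ℕ) : ℤ) + 1, ((π (rot U i) : ℕ) : ℤ) + 1) := by
  constructor
  · intro hp
    obtain ⟨x, y⟩ := p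
    have hx : 1 ≤ x ∧ x ≤ n := by
      by_contra hc
      exact h.profile.not_isVertex (by omega) y hp
    obtain ⟨i, rfl⟩ : ∃ i : Fin n, x = (i : ℕ) + 1 :=
      ⟨⟨(x - 1).toNat, by omega⟩, by simp only; omega⟩
    refine ⟨i, ?_⟩
    rcases (h.isVertex_iff hn i y).1 hp with rfl | rfl
    · exact Or.inl rfl
    · exact Or.inr rfl
  · rintro ⟨i, rfl | rfl⟩
    · exact (h.isVertex_iff hn i _).2 (Or.inl rfl)
    · exact (h.isVertex_iff hn i _).2 (Or.inr rfl)

theorem exists_isVertexList {r : ℕ} {π : Equiv.Perm (Fin (r + 1))} {U : Finset (Fin (r + 1))}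
    (h : Encodes π U P b t) (hn : 2 ≤ r + 1) :
    ∃ A : Fin (2 * (r + 1)) → ℤ × ℤ, IsVertexList P r A ∧
      (Set.range fun i : Fin (r + 1) => A ⟨2 * i, by omega⟩) = graphOf π ∧
      (Set.range fun i : Fin (r + 1) => A ⟨2 * i + 1, by omega⟩) =
        graphOf (π * h.rotPerm hn) := by
  set ρ := h.rotPerm hn with hρ
  have hρa : ∀ i, rot U i = ρ i := fun _ => rfl
  have hcyc : ρ.IsCycleOn ((Finset.univ : Finset (Fin (r + 1))) : Set _) := h.rotPerm_isCycleOn hn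
  -- the traversal starts at the lowest point of `π`
  set x₀ := π.symm ⟨0, by omega⟩ with hx₀
  have hπx₀ : (π x₀ : ℕ) = 0 := by simp [hx₀]
  set a : ℕ → ℤ × ℤ := fun k => (((ρ ^ (k / 2)) x₀ : ℕ) + 1,
    (π ((ρ ^ ((k + 1) / 2)) x₀) : ℕ) + 1) with ha
  have ha0 : ∀ k, a (2 * k) =
      ((((ρ ^ k) x₀ : ℕ) : ℤ) + 1, ((π ((ρ ^ k) x₀) : ℕ) : ℤ) + 1) := fun k => by
    simp only [ha, show 2 * k / 2 = k by omega, show (2 * k + 1) / 2 = k by omega]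
  have ha1 : ∀ k, a (2 * k + 1) =
      ((((ρ ^ k) x₀ : ℕ) : ℤ) + 1, ((π (rot U ((ρ ^ k) x₀)) : ℕ) : ℤ) + 1) := fun k => by
    simp only [ha, show (2 * k + 1) / 2 = k by omega, show (2 * k + 1 + 1) / 2 = k + 1 by omega,
      hρa, pow_succ', Equiv.Perm.mul_apply]
  have hper : a (2 * (r + 1)) = a 0 := by
    have h1 := hcyc.pow_card_apply (Finset.mem_univ x₀)
    rw [Finset.card_univ, Fintype.card_fin] at h1
    rw [ha0, h1]
    simp [ha]
  have hinj : ∀ k l, k < r + 1 → l < r + 1 → (ρ ^ k) x₀ = (ρ ^ l) x₀ → k = l := by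
    intro k l hk hl hkl
    have h1 := (hcyc.pow_apply_eq_pow_apply (Finset.mem_univ x₀)).1 hkl
    rw [Finset.card_univ, Fintype.card_fin] at h1
    exact Nat.ModEq.eq_of_lt_of_lt h1 hk hl
  have hsurj : ∀ i, ∃ k < r + 1, (ρ ^ k) x₀ = i := by
    intro i
    obtain ⟨k, hk, hki⟩ := hcyc.exists_pow_eq (Finset.mem_univ x₀) (Finset.mem_univ i)
    rw [Finset.card_univ, Fintype.card_fin] at hk
    exact ⟨k, hk, hki⟩
  have hA0 : (Set.range fun i : Fin (r + 1) => a (2 * (i : ℕ))) =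
      Set.range fun i : Fin (r + 1) => (((i : ℕ) : ℤ) + 1, ((π i : ℕ) : ℤ) + 1) := by
    ext p
    constructor
    · rintro ⟨k, rfl⟩
      exact ⟨(ρ ^ (k : ℕ)) x₀, (ha0 k).symm⟩
    · rintro ⟨i, rfl⟩
      obtain ⟨k, hk, rfl⟩ := hsurj i
      exact ⟨⟨k, hk⟩, ha0 k⟩
  have hA1 : (Set.range fun i : Fin (r + 1) => a (2 * (i : ℕ) + 1)) =
      Set.range fun i : Fin (r + 1) => (((i : ℕ) : ℤ) + 1, ((π (rot U i) : ℕ) : ℤ) + 1) := by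
    ext p
    constructor
    · rintro ⟨k, rfl⟩
      exact ⟨(ρ ^ (k : ℕ)) x₀, (ha1 k).symm⟩
    · rintro ⟨i, rfl⟩
      obtain ⟨k, hk, rfl⟩ := hsurj i
      exact ⟨⟨k, hk⟩, ha1 k⟩
  refine ⟨fun j => a j, ⟨?_, ?_, ?_, ?_⟩, hA0, hA1⟩
  · intro j j' hjj
    have h1 : (ρ ^ ((j : ℕ) / 2)) x₀ = (ρ ^ ((j' : ℕ) / 2)) x₀ := by
      have := congrArg Prod.fst hjj
      simp only [ha] at this
      exact Fin.ext (by omega)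
    have h2 : (ρ ^ (((j : ℕ) + 1) / 2)) x₀ = (ρ ^ (((j' : ℕ) + 1) / 2)) x₀ := by
      have := congrArg Prod.snd hjj
      simp only [ha] at this
      exact π.injective (Fin.ext (by omega))
    have h3 := hinj _ _ (by omega) (by omega) h1
    -- two distinct consecutive indices would give a fixed point of `ρ`
    have hfix : ∀ k, (ρ ^ k) x₀ ≠ (ρ ^ (k + 1)) x₀ := fun k hk => by
      rw [pow_succ', Equiv.Perm.mul_apply] at hk
      exact h.rot_ne hn _ hk.symm
    have h4 := hfix ((j : ℕ) / 2)
    refine Fin.ext ?_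
    rcases Nat.mod_two_eq_zero_or_one j with e | e <;>
      rcases Nat.mod_two_eq_zero_or_one j' with e' | e'
    · omega
    · rw [show ((j : ℕ) + 1) / 2 = (j : ℕ) / 2 by omega,
        show ((j' : ℕ) + 1) / 2 = (j : ℕ) / 2 + 1 by omega] at h2
      exact absurd h2 h4
    · rw [show ((j : ℕ) + 1) / 2 = (j : ℕ) / 2 + 1 by omega,
        show ((j' : ℕ) + 1) / 2 = (j : ℕ) / 2 by omega] at h2
      exact absurd h2.symm h4
    · omega
  · ext p
    rw [Set.mem_ofPred_eq, h.isVertex_iff_exists hn]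
    constructor
    · rintro ⟨j, rfl⟩
      rcases Nat.even_or_odd' j with ⟨k, hk | hk⟩
      · exact ⟨(ρ ^ k) x₀, Or.inl (by simp only [hk, ha0])⟩
      · exact ⟨(ρ ^ k) x₀, Or.inr (by simp only [hk, ha1])⟩
    · rintro ⟨i, rfl | rfl⟩
      · obtain ⟨k, hk, rfl⟩ := hsurj i
        exact ⟨⟨2 * k, by omega⟩, ha0 k⟩
      · obtain ⟨k, hk, rfl⟩ := hsurj i
        exact ⟨⟨2 * k + 1, by omega⟩, ha1 k⟩
  · intro j
    have hnext : a (finRotate _ j : Fin (2 * (r + 1))) = a (j + 1) := by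
      rw [coe_finRotate_eq_mod]
      rcases (show (j : ℕ) + 1 ≤ 2 * (r + 1) by omega).lt_or_eq with hj | hj
      · rw [Nat.mod_eq_of_lt hj]
      · rw [hj, Nat.mod_self, hper]
    rw [hnext]
    rcases Nat.even_or_odd' j with ⟨k, hk | hk⟩
    · rw [hk, ha0, ha1]
      exact h.vertical_side hn _
    · rw [hk, ha1, show 2 * k + 1 + 1 = 2 * (k + 1) by ring, ha0, pow_succ', Equiv.Perm.mul_apply,
        ← hρa]
      exact h.horizontal_side hn _
  · intro p hp
    have hfirst : a 0 = (((x₀ : ℕ) : ℤ) + 1, 1) := by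
      rw [show 0 = 2 * 0 by rfl, ha0]
      simp [hπx₀]
    simp only [hfirst]
    obtain ⟨i, rfl | rfl⟩ := (h.isVertex_iff_exists hn p).1 hp
    · by_cases hi : (π i : ℕ) = 0
      · rw [show i = x₀ from π.injective (Fin.ext (hi.trans hπx₀.symm))]
        simp [hπx₀]
      · left
        simp only
        omega
    · by_cases hi : (π (rot U i) : ℕ) = 0
      · right
        have hr : rot U i = x₀ := π.injective (Fin.ext (hi.trans hπx₀.symm))
        have hx₀U := h.notMem_of_apply_eq_zero hπx₀
        rcases h.rot_cases hn i with ⟨-, -, -, h1, -⟩ | ⟨-, -, -, -, h1, -⟩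
        · rw [hr] at h1
          exact absurd h1 hx₀U
        · rw [hr, Fin.lt_def] at h1
          simp only
          omega
      · left
        simp only
        omega

theorem isNonemptyPermutomino (h : Encodes π U P b t) (hn : 2 ≤ n) :
    IsNonemptyPermutomino n P π (π * h.rotPerm hn) := by
  obtain ⟨r, rfl⟩ : ∃ r, n = r + 1 := ⟨n - 1, by omega⟩
  obtain ⟨A, hA⟩ := h.exists_isVertexList hn
  have hrange := fun x h1 h2 => h.mem_range (x := x) h1 h2
  have hmem := h.profile.mem_iff
  refine ⟨h.profile.isPolyomino (by omega), h.profile.hasNoHoles (m := 0) (M := (r + 1 : ℕ))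
    (fun x h1 h2 => by have := hrange x h1 h2; omega) (fun x h1 h2 => (hrange x h1 h2).2), ?_, ?_,
    r, A, hA⟩
  · ext x
    simp only [Finset.mem_image, Prod.exists, exists_and_right, exists_eq_right, Finset.mem_Icc]
    constructor
    · rintro ⟨y, hy⟩
      rw [hmem] at hy
      omega
    · intro hx
      have := h.profile.lt x (by omega) (by omega)
      exact ⟨b x, (hmem _ _).2 (by omega)⟩
  · ext y
    simp only [Finset.mem_image, Prod.exists, exists_eq_right, Finset.mem_Icc]
    constructor
    · rintro ⟨x, hx⟩
      rw [hmem] at hx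
      have := hrange x hx.1.1 hx.1.2
      omega
    · intro hy
      obtain ⟨i, hi⟩ : ∃ i, π i = ⟨0, by omega⟩ := π.surjective _
      obtain ⟨j, hj⟩ : ∃ j, π j = ⟨r, by omega⟩ := π.surjective _
      have hiU := h.notMem_of_apply_eq_zero (i := i) (by simp [hi])
      have hjU := h.mem_of_apply_add_one_eq (i := j) (by simp [hj])
      have h1 := h.lt_of_notMem hiU
      have h2 := h.pos_of_mem hjU
      have h3 := h.bot_eq i hiU
      have h4 := h.top_eq j hjU
      rw [hi] at h3
      rw [hj] at h4
      simp only at h3 h4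
      exact h.profile.exists_mem_row (x₁ := (i : ℕ) + 1) (x₂ := (j : ℕ)) (by omega) (by omega)
        (by omega) (by omega) (by omega) (by omega)

theorem isConvex (h : Encodes π U P b t) (hadm : Admissible π U) : IsConvex P := by
  have hmem := h.profile.mem_iff
  refine ⟨fun x => ⟨fun y hy z hz w hw => ?_⟩, fun y => ⟨fun x₁ h₁ x₃ h₃ x₂ h₂ => ?_⟩⟩
  · simp only [Set.mem_ofPred_eq, hmem, Set.mem_Icc] at hy hz hw ⊢
    omega
  · simp only [Set.mem_ofPred_eq, hmem, Set.mem_Icc] at h₁ h₂ h₃ ⊢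
    have hpos : ∀ x : ℤ, 1 ≤ x → x < n → ∃ i : Fin n, (i : ℕ) + 1 < n ∧ x = (i : ℕ) + 1 :=
      fun x hx hx' => ⟨⟨(x - 1).toNat, by omega⟩, by simp only; omega, by simp only; omega⟩
    obtain ⟨i₁, hi₁, rfl⟩ := hpos x₁ h₁.1.1 h₁.1.2
    obtain ⟨i₂, hi₂, rfl⟩ := hpos x₂ (by omega) (by omega)
    obtain ⟨i₃, hi₃, rfl⟩ := hpos x₃ h₃.1.1 h₃.1.2
    have h12 : i₁ ≤ i₂ := Fin.le_def.2 (by omega)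
    have h23 : i₂ ≤ i₃ := Fin.le_def.2 (by omega)
    rw [h.top_apply hi₁, h.bot_apply hi₁] at h₁
    rw [h.top_apply hi₃, h.bot_apply hi₃] at h₃
    rw [h.top_apply hi₂, h.bot_apply hi₂]
    refine ⟨by omega, ?_, ?_⟩
    · obtain ⟨p₁, -, q₁⟩ := h.prv_spec i₁
      obtain ⟨p₂, p₂', q₂⟩ := h.prv_spec i₂
      obtain ⟨p₃, p₃', q₃⟩ := h.prv_spec i₃
      have ha := q₂ _ p₁ ((h.prv_spec i₁).2.1.trans h12)
      have hb := q₃ _ p₂ (p₂'.trans h23)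
      rcases ha.lt_or_eq with ha | ha
      · rcases hb.lt_or_eq with hb | hb
        · by_contra hc
          have h4 := hadm.no_peak _ p₁ _ p₂ _ p₃ ha hb (Fin.lt_def.2 (by omega))
          rw [Fin.lt_def] at h4
          omega
        · rw [hb]
          omega
      · rw [← ha]
        omega
    · obtain ⟨p₁, p₁', q₁⟩ := h.nxt_spec hi₁
      obtain ⟨p₂, p₂', q₂⟩ := h.nxt_spec hi₂
      obtain ⟨p₃, p₃', q₃⟩ := h.nxt_spec hi₃
      have ha := q₁ _ p₂ (h12.trans_lt p₂')
      have hb := q₂ _ p₃ (h23.trans_lt p₃')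
      rcases ha.lt_or_eq with ha | ha
      · rcases hb.lt_or_eq with hb | hb
        · by_contra hc
          have h4 := hadm.no_valley _ p₁ _ p₂ _ p₃ ha hb (Fin.lt_def.2 (by omega))
          rw [Fin.lt_def] at h4
          omega
        · rw [hb]
          omega
      · rw [← ha]
        omega

end Encodes

/-- The cells between the lower and the upper path determined by `π` and `U`. -/
noncomputable def cells (π : Equiv.Perm (Fin n)) (U : Finset (Fin n)) : Finset (ℤ × ℤ) :=
  (Finset.univ.filter fun i : Fin n => (i : ℕ) + 1 < n).biUnion fun i =>
    (Finset.Ico (((π (prv U i) : ℕ) : ℤ) + 1) (((π (nxt U i) : ℕ) : ℤ) + 1)).image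
      fun y => (((i : ℕ) : ℤ) + 1, y)

theorem mem_cells {π : Equiv.Perm (Fin n)} {U : Finset (Fin n)} {x y : ℤ} :
    (x, y) ∈ cells π U ↔ ∃ i : Fin n, (i : ℕ) + 1 < n ∧ x = (i : ℕ) + 1 ∧
      (π (prv U i) : ℕ) + 1 ≤ y ∧ y < (π (nxt U i) : ℕ) + 1 := by
  simp only [cells, Finset.mem_biUnion, Finset.mem_filter, Finset.mem_univ, true_and,
    Finset.mem_image, Finset.mem_Ico, Prod.mk.injEq]
  constructor
  · rintro ⟨i, hi, y, hy, rfl, rfl⟩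
    exact ⟨i, hi, rfl, hy⟩
  · rintro ⟨i, hi, rfl, hy⟩
    exact ⟨i, hi, y, hy, rfl, rfl⟩

theorem Encodes.eq_cells {π : Equiv.Perm (Fin n)} {U : Finset (Fin n)} {P : Finset (ℤ × ℤ)}
    {b t : ℤ → ℤ} (h : Encodes π U P b t) : P = cells π U := by
  ext ⟨x, y⟩
  rw [h.profile.mem_iff, mem_cells]
  constructor
  · rintro ⟨⟨hx, hx'⟩, hy⟩
    obtain ⟨i, hi, rfl⟩ : ∃ i : Fin n, (i : ℕ) + 1 < n ∧ x = (i : ℕ) + 1 :=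
      ⟨⟨(x - 1).toNat, by omega⟩, by simp only; omega, by simp only; omega⟩
    rw [h.top_apply hi, h.bot_apply hi] at hy
    exact ⟨i, hi, rfl, hy⟩
  · rintro ⟨i, hi, rfl, hy⟩
    rw [h.top_apply hi, h.bot_apply hi]
    exact ⟨by omega, hy⟩

theorem Admissible.exists_encodes {π : Equiv.Perm (Fin n)} {U : Finset (Fin n)}
    (h : Admissible π U) : ∃ b t : ℤ → ℤ, Encodes π U (cells π U) b t := by
  have hpos : ∀ x : ℤ, 1 ≤ x → x < n → ∃ i : Fin n, (i : ℕ) + 1 < n ∧ x = (i : ℕ) + 1 :=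
    fun x hx hx' => ⟨⟨(x - 1).toNat, by omega⟩, by simp only; omega, by simp only; omega⟩
  have hex : ∀ x : ℤ, ∃ b t : ℤ, ∀ i : Fin n, x = (i : ℕ) + 1 →
      b = (π (prv U i) : ℕ) + 1 ∧ t = (π (nxt U i) : ℕ) + 1 := by
    intro x
    by_cases hx : ∃ i : Fin n, x = (i : ℕ) + 1
    · obtain ⟨i, rfl⟩ := hx
      refine ⟨(π (prv U i) : ℕ) + 1, (π (nxt U i) : ℕ) + 1, fun j hj => ?_⟩
      rw [show j = i from Fin.ext (by omega)]
      exact ⟨rfl, rfl⟩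
    · exact ⟨0, 0, fun i hi => absurd ⟨i, hi⟩ hx⟩
  choose b t hbt using hex
  have hb : ∀ i : Fin n, b ((i : ℕ) + 1) = (π (prv U i) : ℕ) + 1 := fun i => (hbt _ i rfl).1
  have ht : ∀ i : Fin n, t ((i : ℕ) + 1) = (π (nxt U i) : ℕ) + 1 := fun i => (hbt _ i rfl).2
  have hpred : ∀ i : Fin n, 0 < (i : ℕ) → ∃ j : Fin n, (j : ℕ) + 1 = i :=
    fun i hi => ⟨⟨i - 1, by omega⟩, by simp only; omega⟩
  have hb_notMem : ∀ i ∉ U, b ((i : ℕ) + 1) = (π i : ℕ) + 1 := fun i hi => by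
    rw [hb, prv_eq hi le_rfl fun _ _ hj => hj]
  have ht_mem : ∀ i ∈ U, t (i : ℕ) = (π i : ℕ) + 1 := fun i hi => by
    obtain ⟨j, hj⟩ := hpred i (h.pos_of_mem hi)
    rw [← hj]
    push_cast
    rw [ht, nxt_eq hi (Fin.lt_def.2 (by omega)) fun k _ hk => Fin.le_def.2 (by
      rw [Fin.lt_def] at hk
      omega)]
  have hb_mem : ∀ i ∈ U, b ((i : ℕ) + 1) = b (i : ℕ) := fun i hi => by
    obtain ⟨j, hj⟩ := hpred i (h.pos_of_mem hi)
    obtain ⟨h1, h2, h3⟩ := h.prv_spec j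
    rw [hb, ← hj]
    push_cast
    rw [hb, prv_eq h1 (h2.trans (Fin.le_def.2 (by omega))) fun k hk hki => h3 k hk ?_]
    have : k ≠ i := fun hc => hk (hc ▸ hi)
    rw [ne_eq, Fin.ext_iff] at this
    rw [Fin.le_def] at hki ⊢
    omega
  have ht_notMem : ∀ i ∉ U, 0 < (i : ℕ) → t ((i : ℕ) + 1) = t (i : ℕ) := fun i hi hi0 => by
    obtain ⟨j, hj⟩ := hpred i hi0
    obtain ⟨h1, h2, h3⟩ := h.nxt_spec (h.lt_of_notMem hi)
    rw [ht, ← hj]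
    push_cast
    rw [ht, nxt_eq (i := j) h1 ((Fin.lt_def.2 (by omega)).trans h2) fun k hk hjk => h3 k hk ?_]
    have : k ≠ i := fun hc => hi (hc ▸ hk)
    rw [ne_eq, Fin.ext_iff] at this
    rw [Fin.lt_def] at hjk ⊢
    omega
  have hlt : ∀ x : ℤ, 1 ≤ x → x < n → b x < t x := fun x hx hx' => by
    obtain ⟨i, hi, rfl⟩ := hpos x hx hx'
    have := h.sep i hi
    rw [Fin.lt_def] at this
    rw [hb, ht]
    omega
  -- only one of the two functions changes at each abscissa, so consecutive columns overlap
  have hstep : ∀ x : ℤ, 1 ≤ x → x + 1 < n → b (x + 1) = b x ∨ t (x + 1) = t x := fun x hx hx' => by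
    obtain ⟨i, rfl⟩ : ∃ i : Fin n, x = (i : ℕ) := ⟨⟨x.toNat, by omega⟩, by simp only; omega⟩
    by_cases hi : i ∈ U
    · exact Or.inl (hb_mem i hi)
    · exact Or.inr (ht_notMem i hi (by omega))
  refine ⟨b, t, h.toAnchored, ⟨fun x y => ?_, hlt, fun x hx hx' => ?_, fun x hx hx' => ?_⟩, ht_mem,
    hb_notMem, fun i hi _ => hb_mem i hi, ht_notMem⟩
  · rw [mem_cells]
    constructor
    · rintro ⟨i, hi, rfl, hy⟩
      rw [hb, ht]
      exact ⟨by omega, hy⟩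
    · rintro ⟨⟨hx, hx'⟩, hy⟩
      obtain ⟨i, hi, rfl⟩ := hpos x hx hx'
      rw [hb, ht] at hy
      exact ⟨i, hi, rfl, hy⟩
  · have h1 := hlt x hx (by omega)
    have h2 := hlt (x + 1) (by omega) hx'
    rcases hstep x hx hx' with h3 | h3 <;> omega
  · have h1 := hlt x hx (by omega)
    have h2 := hlt (x + 1) (by omega) hx'
    rcases hstep x hx hx' with h3 | h3 <;> omega

theorem Admissible.cells_mem_associated {π : Equiv.Perm (Fin n)} {U : Finset (Fin n)}
    (h : Admissible π U) (hn : 2 ≤ n) : cells π U ∈ associated π := by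
  obtain ⟨b, t, henc⟩ := h.exists_encodes
  have hP := henc.isNonemptyPermutomino hn
  exact ⟨⟨henc.isConvex h, π, _, Or.inr hP⟩, _, Or.inr hP⟩

/-- The position set is recovered from the region: its elements are the positions at which the top
of the column to the left is the ordinate of the point of `π`. -/
theorem cells_injOn (π : Equiv.Perm (Fin n)) : Set.InjOn (cells π) {U | Admissible π U} := by
  have key : ∀ U V, Admissible π U → Admissible π V → cells π U = cells π V → U ⊆ V := by
    intro U V hU hV heq i hi
    have hpos := hU.pos_of_mem hi
    obtain ⟨j, hj⟩ : ∃ j : Fin n, (j : ℕ) + 1 = i := ⟨⟨i - 1, by omega⟩, by simp only; omega⟩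
    have hjn : (j : ℕ) + 1 < n := by omega
    have hU' : nxt U j = i := nxt_eq hi (Fin.lt_def.2 (by omega)) fun k _ hk => Fin.le_def.2 (by
      rw [Fin.lt_def] at hk
      omega)
    have hcol : ∀ y : ℤ, ((π (prv U j) : ℕ) + 1 ≤ y ∧ y < (π (nxt U j) : ℕ) + 1) ↔
        ((π (prv V j) : ℕ) + 1 ≤ y ∧ y < (π (nxt V j) : ℕ) + 1) := by
      intro y
      have hmem : ∀ W : Finset (Fin n), (((j : ℕ) : ℤ) + 1, y) ∈ cells π W ↔
          ((π (prv W j) : ℕ) + 1 ≤ y ∧ y < (π (nxt W j) : ℕ) + 1) := by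
        intro W
        rw [mem_cells]
        constructor
        · rintro ⟨k, -, hk, hy⟩
          rwa [show k = j from Fin.ext (by omega)] at hy
        · exact fun hy => ⟨j, hjn, rfl, hy⟩
      rw [← hmem, ← hmem, heq]
    have h1 := hU.sep j hjn
    have h2 := hV.sep j hjn
    rw [Fin.lt_def] at h1 h2
    have h3 := hcol (π (nxt U j) : ℕ)
    have h4 := hcol (π (nxt V j) : ℕ)
    have h5 : nxt U j = nxt V j := π.injective (Fin.ext (by omega))
    rw [← hU', h5]
    exact (hV.nxt_spec hjn).1
  exact fun U hU V hV heq => Finset.Subset.antisymm (key U V hU hV heq) (key V U hV hU heq.symm)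

/-! ### From convex permutominoes to admissible sets -/

theorem IsClockwiseSide.exists_step {P : Finset (ℤ × ℤ)} {p q : ℤ × ℤ}
    (h : IsClockwiseSide P p q) :
    ∃ d : Step, IsBoundaryStep P p d ∧ IsBoundaryStep P (q - d.vec) d := by
  obtain ⟨d, k, hk, rfl, hstep⟩ := h
  refine ⟨d, by simpa using hstep 0 hk, ?_⟩
  obtain ⟨k, rfl⟩ : ∃ l, k = l + 1 := ⟨k - 1, by omega⟩
  have := hstep k (by omega)
  rwa [show p + (k + 1) • d.vec - d.vec = p + k • d.vec by rw [succ_nsmul]; abel]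

/-- The first vertex is left northwards: it is the lower left corner of the lowest row. -/
theorem first_step_isVertical {P : Finset (ℤ × ℤ)} {b t : ℤ → ℤ} {N : ℤ}
    (hprof : ColumnProfile N P b t) (hb : ∀ x, 1 ≤ x → x < N → 1 ≤ b x) {p : ℤ × ℤ} {d : Step}
    (hd : IsBoundaryStep P p d) (hp : p.2 = 1)
    (hmin : ∀ q, IsVertex P q → q.2 = 1 → p.1 ≤ q.1) : d.IsVertical := by
  obtain ⟨x, y⟩ := p
  simp only at hp hmin
  subst hp
  have hrow0 : ∀ z, (z, (0 : ℤ)) ∉ P := fun z hz => by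
    rw [hprof.mem_iff] at hz
    have := hb z hz.1.1 hz.1.2
    omega
  cases d with
  | north => trivial
  | south => trivial
  | east => exact absurd hd.1 (hrow0 x)
  | west =>
    exfalso
    obtain ⟨m, hm, hmin'⟩ := Set.exists_min_image {z : ℤ | (z, (1 : ℤ)) ∈ P} id
      (P.finite_toSet.preimage (f := fun z => (z, 1)) fun _ _ _ _ h => by simpa using h)
      ⟨x - 1, hd.1⟩
    have h1 := hmin' (x - 1) hd.1
    have h2 : (m - 1, (1 : ℤ)) ∉ P := fun hc => by
      have := hmin' (m - 1) hc
      simp only [id] at this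
      omega
    have hv : IsVertex P (m, 1) := by
      rw [hprof.isVertex_iff_odd]
      have hm : (m, (1 : ℤ)) ∈ P := hm
      simp [hm, h2, hrow0]
    have h3 := hmin _ hv rfl
    simp only [id] at h1 h3
    omega

/-- The vertices alternate between those left vertically and those left horizontally, so the points
of `π₁` are left vertically. -/
theorem IsVertexList.step_isVertical {P : Finset (ℤ × ℤ)} {b t : ℤ → ℤ} {N : ℤ} {r : ℕ}
    {A : Fin (2 * (r + 1)) → ℤ × ℤ} (hA : IsVertexList P r A) (hprof : ColumnProfile N P b t)
    (hfirst : ∀ d, IsBoundaryStep P (A ⟨0, by omega⟩) d → d.IsVertical) (i : Fin (r + 1)) :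
    ∃ d : Step, IsBoundaryStep P (A ⟨2 * i, by omega⟩) d ∧ d.IsVertical := by
  choose d hleave harrive using fun i => (hA.side i).exists_step
  have hperp : ∀ i, (d i).IsVertical ↔ ¬ (d (finRotate _ i)).IsVertical := by
    intro i
    have hv : IsVertex P (A (finRotate _ i)) := by
      have : A (finRotate _ i) ∈ {p | IsVertex P p} := hA.range_eq ▸ Set.mem_range_self _
      exact this
    obtain ⟨e, e', h1, h2, h3⟩ := hv
    rwa [hprof.arriving_unique h1 (harrive i), hprof.leaving_unique h2 (hleave _)] at h3
  have hnext : ∀ k (hk : k + 1 < 2 * (r + 1)),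
      finRotate _ (⟨k, by omega⟩ : Fin (2 * (r + 1))) = ⟨k + 1, hk⟩ := fun k hk =>
    Fin.ext (by rw [coe_finRotate_eq_mod, Nat.mod_eq_of_lt hk])
  have hpar : ∀ k (hk : k < 2 * (r + 1)), (d ⟨k, hk⟩).IsVertical ↔ Even k := by
    intro k
    induction k with
    | zero =>
      intro hk
      simpa using hfirst _ (hleave ⟨0, hk⟩)
    | succ k ih =>
      intro hk
      have h1 := hperp ⟨k, by omega⟩
      rw [hnext k hk, ih (by omega)] at h1
      rw [Nat.even_add_one]
      tauto
  exact ⟨_, hleave _, (hpar _ _).2 (even_two_mul _)⟩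

theorem IsNonemptyPermutomino.exists_encodes {P : Finset (ℤ × ℤ)} {π π₂ : Equiv.Perm (Fin n)}
    (hP : IsNonemptyPermutomino n P π π₂) (hconv : IsColumnConvex P) (hn : 2 ≤ n) :
    ∃ (U : Finset (Fin n)) (b t : ℤ → ℤ), Encodes π U P b t := by
  obtain ⟨b, t, hprof⟩ := exists_columnProfile hP.polyomino hconv hP.columns
  obtain ⟨r, A, hA, hA1, hA2⟩ := hP.vertices
  have hmem := hprof.mem_iff
  have hb1 : ∀ x : ℤ, 1 ≤ x → x < n → 1 ≤ b x := fun x hx hx' => by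
    have hx : (x, b x) ∈ P := (hmem _ _).2 ⟨⟨hx, hx'⟩, le_rfl, hprof.lt x hx hx'⟩
    have := Finset.mem_image_of_mem Prod.snd hx
    rw [hP.rows, Finset.mem_Icc] at this
    exact this.1
  have hvert : ∀ i : Fin n, ∀ y : ℤ, IsVertex P ((i : ℕ) + 1, y) ↔
      y = (π i : ℕ) + 1 ∨ y = (π₂ i : ℕ) + 1 := by
    have hgraph : ∀ (σ : Equiv.Perm (Fin n)) (i : Fin n) (y : ℤ),
        (((i : ℕ) : ℤ) + 1, y) ∈ graphOf σ ↔ y = (σ i : ℕ) + 1 := by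
      intro σ i y
      constructor
      · rintro ⟨j, hj⟩
        have h1 := congrArg Prod.fst hj
        have h2 := congrArg Prod.snd hj
        simp only at h1 h2
        rw [← h2, show j = i from Fin.ext (by omega)]
      · rintro rfl
        exact ⟨i, rfl⟩
    intro i y
    rw [← hgraph π, ← hgraph π₂, ← hA1, ← hA2]
    have hr : (((i : ℕ) : ℤ) + 1, y) ∈ Set.range A ↔ IsVertex P (((i : ℕ) : ℤ) + 1, y) := by
      rw [hA.range_eq]
      rfl
    rw [← hr]
    constructor
    · rintro ⟨j, hj⟩
      rcases Nat.even_or_odd' j with ⟨k, hk | hk⟩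
      · exact Or.inl ⟨⟨k, by omega⟩, (congrArg A (Fin.ext hk.symm)).trans hj⟩
      · exact Or.inr ⟨⟨k, by omega⟩, (congrArg A (Fin.ext hk.symm)).trans hj⟩
    · rintro (⟨k, hk⟩ | ⟨k, hk⟩)
      · exact ⟨_, hk⟩
      · exact ⟨_, hk⟩
  have hfirst : ∀ d, IsBoundaryStep P (A ⟨0, by omega⟩) d → d.IsVertical := by
    intro d hd
    have hy : (A ⟨0, by omega⟩).2 = 1 := by
      have hge : 1 ≤ (A ⟨0, by omega⟩).2 := by
        have : A ⟨0, by omega⟩ ∈ graphOf π := hA1 ▸ ⟨⟨0, by omega⟩, rfl⟩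
        obtain ⟨j, hj⟩ := this
        rw [← hj]
        simp
      have hle := hA.first _ ((hvert (π.symm ⟨0, by omega⟩) 1).2 (Or.inl (by simp)))
      simp only at hle
      omega
    refine first_step_isVertical hprof hb1 hd hy fun q hq hq1 => ?_
    have := hA.first q hq
    omega
  -- the point of `π` at position `i` is left northwards or southwards
  have hleave : ∀ i : Fin n,
      ((((i : ℕ) : ℤ) + 1, ((π i : ℕ) : ℤ) + 1) ∈ P ∧ (((i : ℕ) : ℤ), ((π i : ℕ) : ℤ) + 1) ∉ P) ∨
      ((((i : ℕ) : ℤ), ((π i : ℕ) : ℤ)) ∈ P ∧ (((i : ℕ) : ℤ) + 1, ((π i : ℕ) : ℤ)) ∉ P) := by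
    intro i
    have : (((i : ℕ) : ℤ) + 1, ((π i : ℕ) : ℤ) + 1) ∈ graphOf π := ⟨i, rfl⟩
    rw [← hA1] at this
    obtain ⟨j, hj⟩ := this
    simp only at hj
    obtain ⟨d, hd, hdv⟩ := hA.step_isVertical hprof hfirst j
    rw [hj] at hd
    cases d with
    | north => left; simpa [isBoundaryStep_iff, Step.rightCell, Step.leftCell] using hd
    | south => right; simpa [isBoundaryStep_iff, Step.rightCell, Step.leftCell] using hd
    | east => exact hdv.elim
    | west => exact hdv.elim
  have hbot0 : ∀ i : Fin n, (i : ℕ) = 0 → b ((i : ℕ) + 1) = (π i : ℕ) + 1 := by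
    intro i hi
    have h1 := hleave i
    have h2 := (hvert i ((π i : ℕ) + 1)).2 (Or.inl rfl)
    rw [hi] at h1 h2 ⊢
    simp only [Nat.cast_zero, zero_add] at h1 h2 ⊢
    rw [hprof.isVertex_first (by omega)] at h2
    rw [hmem, hmem, hmem, hmem] at h1
    omega
  have htop_last : ∀ i : Fin n, (i : ℕ) + 1 = n → t (i : ℕ) = (π i : ℕ) + 1 := by
    intro i hi
    have h1 := hleave i
    have h2 := (hvert i ((π i : ℕ) + 1)).2 (Or.inl rfl)
    rw [show (((i : ℕ) : ℤ) + 1) = n by omega, hprof.isVertex_last (by omega),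
      show (n : ℤ) - 1 = (i : ℕ) by omega] at h2
    rw [hmem, hmem, hmem, hmem] at h1
    omega
  have hinner : ∀ i : Fin n, 0 < (i : ℕ) → (i : ℕ) + 1 < n →
      (t (i : ℕ) = (π i : ℕ) + 1 ∧ b ((i : ℕ) + 1) = b (i : ℕ)) ∨
      (b ((i : ℕ) + 1) = (π i : ℕ) + 1 ∧ t ((i : ℕ) + 1) = t (i : ℕ)) := by
    intro i hi hi'
    have h1 := hleave i
    rw [hmem, hmem, hmem, hmem] at h1
    have h2 : ∀ y : ℤ, (y = (π i : ℕ) + 1 ∨ y = (π₂ i : ℕ) + 1) ↔ _ := fun y =>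
      (hvert i y).symm.trans (hprof.isVertex_inner (x := (i : ℕ)) (by omega) (by omega) y)
    have k1 := hprof.lt (i : ℕ) (by omega) (by omega)
    have k2 := hprof.lt ((i : ℕ) + 1) (by omega) (by omega)
    have k3 := hprof.lt_succ (i : ℕ) (by omega) (by omega)
    have k4 := hprof.succ_lt (i : ℕ) (by omega) (by omega)
    have m1 := h2 (b (i : ℕ))
    have m2 := h2 (b ((i : ℕ) + 1))
    have m3 := h2 (t (i : ℕ))
    have m4 := h2 (t ((i : ℕ) + 1))
    have m5 := h2 ((π i : ℕ) + 1)
    -- if both functions changed, there would be four vertices with this abscissa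
    have hone : b ((i : ℕ) + 1) = b (i : ℕ) ∨ t ((i : ℕ) + 1) = t (i : ℕ) := by
      clear h1
      omega
    clear m1 m2 m3 m4
    rcases hone with hone | hone
    · exact Or.inl ⟨by omega, hone⟩
    · exact Or.inr ⟨by omega, hone⟩
  refine ⟨Finset.univ.filter fun i : Fin n => 0 < (i : ℕ) ∧ t (i : ℕ) = (π i : ℕ) + 1, b, t,
    ⟨fun i hi => ?_, fun i hi => ?_⟩, hprof, fun i hi => ?_, fun i hi => ?_, fun i hi hin => ?_,
    fun i hi hpos => ?_⟩ <;>
    simp only [Finset.mem_filter, Finset.mem_univ, true_and] at *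
  · omega
  · exact ⟨by omega, htop_last i hi⟩
  · exact hi.2
  · by_cases h0 : (i : ℕ) = 0
    · exact hbot0 i h0
    · have hne : t (i : ℕ) ≠ (π i : ℕ) + 1 := fun hc => hi ⟨by omega, hc⟩
      have hlast : (i : ℕ) + 1 ≠ n := fun hc => hne (htop_last i hc)
      rcases hinner i (by omega) (by omega) with h1 | h1
      · exact absurd h1.1 hne
      · exact h1.1
  · rcases hinner i hi.1 hin with h1 | h1
    · exact h1.2
    · have := hprof.succ_lt (i : ℕ) (by omega) (by omega)
      omega
  · have hne : t (i : ℕ) ≠ (π i : ℕ) + 1 := fun hc => hi ⟨by omega, hc⟩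
    have hlast : (i : ℕ) + 1 ≠ n := fun hc => hne (htop_last i hc)
    rcases hinner i (by omega) (by omega) with h1 | h1
    · exact absurd h1.1 hne
    · exact h1.2

theorem Encodes.admissible {π : Equiv.Perm (Fin n)} {U : Finset (Fin n)} {P : Finset (ℤ × ℤ)}
    {b t : ℤ → ℤ} (h : Encodes π U P b t) (hconv : IsRowConvex P) : Admissible π U := by
  have hmem := h.profile.mem_iff
  have hrow : ∀ x₁ x₂ x₃ y, 1 ≤ x₁ → x₁ ≤ x₂ → x₂ ≤ x₃ → x₃ < (n : ℤ) → b x₁ ≤ y → y < t x₁ →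
      b x₃ ≤ y → y < t x₃ → b x₂ ≤ y ∧ y < t x₂ := by
    intro x₁ x₂ x₃ y h1 h2 h3 h4 h5 h6 h7 h8
    have hm₁ : (x₁, y) ∈ P := (hmem _ _).2 (by omega)
    have hm₃ : (x₃, y) ∈ P := (hmem _ _).2 (by omega)
    have hm₂ : (x₂, y) ∈ P := (hconv y).out hm₁ hm₃ ⟨h2, h3⟩
    exact ((hmem _ _).1 hm₂).2
  refine ⟨h.toAnchored, fun i hi => ?_, fun i hi j hj k hk hij hjk hlt => ?_,
    fun i hi j hj k hk hij hjk hlt => ?_⟩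
  · have := h.profile.lt ((i : ℕ) + 1) (by omega) (by omega)
    rw [h.top_apply hi, h.bot_apply hi] at this
    rw [Fin.lt_def]
    omega
  · have hpos := h.pos_of_mem hi
    refine lt_of_le_of_ne ?_ (π.injective.ne hij.ne)
    rw [Fin.lt_def] at hij hjk hlt
    have := no_valley_of_rowConvex h.profile.lt_succ hrow h.profile.succ_lt (x₁ := (i : ℕ))
      (x₂ := (j : ℕ)) (x₃ := (k : ℕ)) (by omega) (by omega) (by omega) (by omega)
      (by rw [h.top_eq j hj, h.top_eq k hk]; omega)
    rw [h.top_eq i hi, h.top_eq j hj] at this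
    rw [Fin.le_def]
    omega
  · have hlast := h.lt_of_notMem hk
    refine lt_of_le_of_ne ?_ (π.injective.ne hij.ne')
    rw [Fin.lt_def] at hij hjk hlt
    -- reflecting the region in a horizontal line turns peaks of the bottom into valleys of the top
    have := no_valley_of_rowConvex (n := n) (b := fun x => - t x) (t := fun x => - b x)
      (fun x hx hx' => neg_lt_neg (h.profile.succ_lt x hx hx'))
      (fun x₁ x₂ x₃ y h1 h2 h3 h4 h5 h6 h7 h8 => by
        have := hrow x₁ x₂ x₃ (- y - 1) h1 h2 h3 h4 (by omega) (by omega) (by omega) (by omega)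
        omega)
      (fun x hx hx' => neg_lt_neg (h.profile.lt_succ x hx hx'))
      (x₁ := (i : ℕ) + 1) (x₂ := (j : ℕ) + 1) (x₃ := (k : ℕ) + 1) (by omega) (by omega) (by omega)
      (by omega) (by rw [h.bot_eq j hj, h.bot_eq k hk]; omega)
    rw [h.bot_eq i hi, h.bot_eq j hj] at this
    rw [Fin.le_def]
    omega

theorem mem_associated_iff {π : Equiv.Perm (Fin n)} (hn : 2 ≤ n) {P : Finset (ℤ × ℤ)} :
    P ∈ associated π ↔ ∃ U, Admissible π U ∧ cells π U = P := by
  constructor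
  · rintro ⟨⟨hconv, -⟩, π₂, hP⟩
    have hP := hP.resolve_left (by omega)
    obtain ⟨U, b, t, h⟩ := hP.exists_encodes hconv.1 hn
    exact ⟨U, h.admissible hconv.2, h.eq_cells.symm⟩
  · rintro ⟨U, hU, rfl⟩
    exact hU.cells_mem_associated hn

/-! ### Counting -/

theorem not_isNonemptyPermutomino_of_lt_two {P : Finset (ℤ × ℤ)} {π π₂ : Equiv.Perm (Fin n)}
    (hn : n < 2) : ¬ IsNonemptyPermutomino n P π π₂ := by
  intro hP
  obtain ⟨⟨p, hp⟩⟩ := hP.polyomino.nonempty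
  have := Finset.mem_image_of_mem Prod.fst (Finset.mem_coe.1 hp)
  rw [hP.columns, Finset.mem_Icc] at this
  omega

theorem associated_eq_of_lt_two {π : Equiv.Perm (Fin n)} (hn : n < 2) {P : Finset (ℤ × ℤ)}
    (hP : P ∈ associated π) : associated π = {∅} := by
  have hempty : ∀ Q ∈ associated π, Q = ∅ := by
    rintro Q ⟨-, π₂, hQ⟩
    exact (hQ.resolve_right (not_isNonemptyPermutomino_of_lt_two hn)).2
  refine Set.eq_singleton_iff_unique_mem.2 ⟨?_, hempty⟩
  rwa [hempty P hP] at hP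

end Permutomino

theorem mainTheorem3 {n : ℕ} (π : Equiv.Perm (Fin n))
    (hπ : π ∈ Permutomino.associatedPerms n) :
    (Permutomino.associated π).Finite ∧
      (Permutomino.associated π).ncard = 2 ^ (Permutomino.freeFixedPoints π).ncard := by
  open Permutomino in
  obtain ⟨P, hconv, hP⟩ := hπ
  have hmem : P ∈ associated π := ⟨hconv, hP⟩
  rcases lt_or_ge n 2 with hn | hn
  · have hfree : freeFixedPoints π = ∅ :=
      Set.eq_empty_of_forall_notMem fun i hi => by
        have := mem_freeFixedPoints_iff.1 hi
        omega
    rw [associated_eq_of_lt_two hn hmem, hfree]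
    simp
  · have himage : associated π = cells π '' {U | Admissible π U} := by
      ext Q
      exact mem_associated_iff hn
    obtain ⟨U, hU, -⟩ := (mem_associated_iff hn).1 hmem
    rw [himage, (cells_injOn π).ncard_image, hU.ncard_setOf]
    exact ⟨(Set.toFinite _).image _, rfl⟩
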